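/- **Drawings.** Near-triangulations $G$ are finite simple connected plane graphs all of whose finite regions are triangles; we only consider those for which $G\setminus v$ is connected for every vertex $v$. A *configuration* $K$ is such a near-triangulation $G(K)$ with a map $\gamma_K:V(G(K))\to\{5,6,\dots\}$ such that $\gamma_K(v)=\deg(v)$ if $v$ is not incident with the infinite region, and $\gamma_K(v)>\deg(v)$ otherwise. A *pass* $P=(K,r,s,t)$ consists of a configuration $K$, an integer $r>0$ and adjacent vertices $s=s(P)$ (source), $t=t(P)$ (sink) such that every vertex of $K$ is joined to $s$ and to $t$ by paths with at most two edges. A *rule* $R=(G,\beta,\delta,r,s,t)$ consists of a near-triangulation $G$ as above, maps $\beta\le\delta$ on $V(G)$, an integer $r>0$ and adjacent vertices $s,t$ such that every vertex is joined to $s$ and to $t$ by paths with at most two edges whose inner vertex $w$, if any, has $\delta(w)\le 8$. A pass *obeys* $R$ if it is isomorphic to some $(K,r,s,t)$ with $G(K)=G$ and $\beta\le\gamma_K\le\delta$; it *orientation-obeys* $R$ (written $P\approx\{R\}$), respectively *anti-orientation-obeys* $R$, if the isomorphism can be chosen to preserve, respectively reverse, the orientation of the drawing. **Cartwheels.** A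 *cartwheel* $W$ with hub of degree $d\ge5$ has the following vertices: the hub $0$; spokes $1,\dots,d$, forming in this clockwise order a circuit around the hub, all adjacent to the hub; hats $d+1,\dots,2d$, where $d+i$ is adjacent to $i$ and $i+1$ ($2d$ to $d$ and $1$); and for each spoke $i$, of degree $k_i\ge5$, the $k_i-5$ fan vertices $2d+i,3d+i,\dots,(k_i-4)d+i$, adjacent to $i$, such that the hat preceding $i$ (the one adjacent to $i-1$ and $i$), the vertices $2d+i,\dots,(k_i-4)d+i$, and $d+i$ form a path in this clockwise order; these paths together form the outer circuit. There are no other edges. $W$ carries a map $\gamma_W\ge5$ that equals the degree at the hub and the spokes and is arbitrary at hats and fan vertices. A pass $P=(K,r,s,t)$ *appears* in $W$ if $G(K)$ is an induced subdrawing of $W$ whose finite regions are finite regions of $W$, and $\gamma_K$ is the restriction of $\gamma_W$. **Coherence.** $R$ is *coherent* if (a) whenever a pass $P$ obeying $R$ appears in a cartwheel with $s(P)$ or $t(P)$ at the hub, and $P$ contains a fan vertex $v$, then $P$ contains the spoke $u$ adjacent to $v$, and $\beta(u')=\delta(u')$ for the vertex $u'$ of $G$ corresponding to $u$; and (b) if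 some pass both orientation-obeys and anti-orientation-obeys $R$, then every pass that orientation-obeys $R$ also anti-orientation-obeys $R$. **Axles.** An *axle* $A$ of degree $d$ is a pair of maps $l_A,u_A$ on $\{1,\dots,5d\}$ with $l_A\le u_A$, $l_A(i)\in\{5,6,7,8,9\}$, $u_A(i)\in\{5,6,7,8,12\}$, such that for $1\le i\le d$ with $l_A(i)\ne u_A(i)$ we have $(l_A,u_A)(jd+i)=(5,12)$ for $j=2,3,4$. A cartwheel $W$ with hub of degree $d$ is *compatible* with $A$ if $l_A(n)\le\gamma_W(n)\le u_A(n)$ for all $1\le n\le 2d$ and for all $n=jd+i$ with $1\le i\le d$, $l_A(i)=u_A(i)$ and $2\le j\le l_A(i)-4$. **Outlets.** An *outlet* $T=(M,r)$ of degree $d$ consists of a non-zero integer $r=r(T)$ and a finite set $M$ of triples $(p,l,u)$ of integers with $1\le p\le 5d$, $l\le u$, $l\in\{5,6,7,8,9\}$, $u\in\{5,6,7,8,12\}$, such that if $(p,l,u)\in M$ with $p=jd+i$, $j\in\{2,3,4\}$, $1\le i\le d$, then $(i,k,k)\in M$ for some $k\ge j+4$. It is *reduced* if the first entries of the triples are pairwise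 distinct and no triple is $(p,5,12)$. Let $i\oplus_d x=i+x$ if $x+((i-1)\bmod d)<d$, and $i\oplus_d x=i+x-d$ otherwise. For $x\in\{1,\dots,d\}$, $(T,x)$ is *enforced* by $A$ if $l\le l_A(q)\le u_A(q)\le u$, and *permitted* by $A$ if $u\ge l_A(q)$ and $u_A(q)\ge l$, for all $(p,l,u)\in M$, where $q=p\oplus_d(x-1)$. **Theorem.** Let $d\in\{7,8,9,10,11\}$ and let $R=(G,\beta,\delta,r,s,t)$ be a coherent rule with $\beta(v)\in\{5,6,7,8,9\}$ and $\delta(v)\in\{5,6,7,8,12\}$ for all $v\in V(G)$. 1. Some cartwheel with hub of degree $d$ contains a pass $P\approx\{R\}$ whose sink is the hub and whose source is a spoke if and only if there is a unique reduced outlet $T$ of degree $d$ with $r(T)=r$ such that for every axle $A$ of degree $d$ and every $x\in\{1,\dots,d\}$: (i) $(T,x)$ is enforced by $A$ if and only if in every cartwheel $W$ compatible with $A$ there appears a pass $P\approx\{R\}$ with $s(P)=x$, $t(P)=0$; (iii) $(T,x)$ is permitted by $A$ if and only if in some cartwheel $W$ compatible with $A$ there appears a pass $P\approx\{R\}$ with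 $s(P)=x$, $t(P)=0$. 2. Some cartwheel with hub of degree $d$ contains a pass $P\approx\{R\}$ whose source is the hub and whose sink is a spoke if and only if there is a unique reduced outlet $T'$ of degree $d$ with $r(T')=-r$ such that for every axle $A$ of degree $d$ and every $x\in\{1,\dots,d\}$: (ii) $(T',x)$ is enforced by $A$ if and only if in every cartwheel $W$ compatible with $A$ there appears a pass $P\approx\{R\}$ with $s(P)=0$, $t(P)=x$; (iv) $(T',x)$ is permitted by $A$ if and only if in some cartwheel $W$ compatible with $A$ there appears a pass $P\approx\{R\}$ with $s(P)=0$, $t(P)=x$. -/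

import Mathlib

/-! ## Near-triangulations, configurations, passes and rules -/

/-- A plane near-triangulation `G` such that `G \ v` is connected for every vertex `v`, given by its
underlying graph and the relation `tri a b c`: "`a, b, c` are, in clockwise order, the vertices of a
finite region of the drawing".

The finite regions are triangles (`tri_rotate`, `tri_adj`), and a finite region is determined by any
one of its edges, traversed clockwise (`tri_unique`). The regions and edges at a vertex `v` form one
contiguous fan around `v` (`link_connected`), which says that `v` is not a cutvertex. Finally
`|V| - |E| + |F| = 1`, where `F` is the set of finite regions, each counted three times by `tri`.
So the vertices, edges and finite regions form an oriented triangulated disc (or a single edge, or a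
single vertex); the drawing is determined by these data up to an orientation-preserving
homeomorphism of the plane, and the orientation-preserving isomorphisms of drawings are the
bijections that preserve adjacency and `tri`. -/
structure NearTriangulation (V : Type) [Fintype V] where
  graph : SimpleGraph V
  tri : V → V → V → Prop
  tri_rotate : ∀ a b c, tri a b c → tri b c a
  tri_adj : ∀ a b c, tri a b c → graph.Adj a b
  tri_unique : ∀ a b c c', tri a b c → tri a b c' → c = c'
  connected : graph.Connected
  link_connected : ∀ v a b, graph.Adj v a → graph.Adj v b →
    Relation.EqvGen (fun x y => tri v x y) a b
  euler : 3 * Fintype.card V + {p : V × V × V | tri p.1 p.2.1 p.2.2}.ncard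
    = 3 * (graph.edgeSet.ncard + 1)

/-- `v` is not incident with the infinite region: every edge at `v` is followed, clockwise around
`v`, by a finite region. -/
def NearTriangulation.Interior {V : Type} [Fintype V] (G : NearTriangulation V) (v : V) : Prop :=
  ∀ a, G.graph.Adj v a → ∃ b, G.tri v a b

/-- A configuration (without cutvertices) `(G, γ)`: `γ v` is the degree of `v` if `v` is not incident
with the infinite region, it exceeds the degree of `v` otherwise, and `γ v ≥ 5` in both cases. -/
structure Configuration (V : Type) [Fintype V] extends NearTriangulation V where
  γ : V → ℕ
  γ_interior : ∀ v, toNearTriangulation.Interior v → γ v = (graph.neighborSet v).ncard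
  γ_boundary : ∀ v, ¬ toNearTriangulation.Interior v → (graph.neighborSet v).ncard < γ v
  five_le_γ : ∀ v, 5 ≤ γ v

/-- A pass `(K, r, s, t)`: a configuration `K`, a positive integer `r` (its value) and two adjacent
vertices `s` (its source) and `t` (its sink) such that every vertex of `K` is joined to `s`, and also
to `t`, by a path with at most two edges. -/
structure Pass (V : Type) [Fintype V] extends Configuration V where
  r : ℕ
  s : V
  t : V
  r_pos : 0 < r
  adj_st : graph.Adj s t
  near_s : ∀ v, v = s ∨ graph.Adj v s ∨ ∃ w, graph.Adj v w ∧ graph.Adj w s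
  near_t : ∀ v, v = t ∨ graph.Adj v t ∨ ∃ w, graph.Adj v w ∧ graph.Adj w t

/-- A rule `(G, β, δ, r, s, t)`: a near-triangulation `G` such that `G \ v` is connected for each
vertex `v`, bounds `β ≤ δ` on its vertices, a positive integer `r` and two adjacent vertices `s`, `t`
such that every vertex is joined to `s`, and also to `t`, by a path with at most two edges
whose inner vertex `w`, if there is one, satisfies `δ w ≤ 8`. -/
structure Rule (V : Type) [Fintype V] extends NearTriangulation V where
  β : V → ℕ
  δ : V → ℕ
  r : ℕ
  s : V
  t : V
  β_le_δ : ∀ v, β v ≤ δ v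
  r_pos : 0 < r
  adj_st : graph.Adj s t
  near_s : ∀ v, v = s ∨ graph.Adj v s ∨ ∃ w, graph.Adj v w ∧ graph.Adj w s ∧ δ w ≤ 8
  near_t : ∀ v, v = t ∨ graph.Adj v t ∨ ∃ w, graph.Adj v w ∧ graph.Adj w t ∧ δ w ≤ 8

/-- The bijection `e` shows that the pass `P` is isomorphic to some `(K, r, s, t)` with `G(K) = G` and
`β ≤ γ_K ≤ δ`, where `R = (G, β, δ, r, s, t)`; the orientation of the drawings is left aside. -/
def Pass.MatchesVia {U V : Type} [Fintype U] [Fintype V] (P : Pass U) (R : Rule V)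
    (e : U ≃ V) : Prop :=
  (∀ a b, P.graph.Adj a b ↔ R.graph.Adj (e a) (e b)) ∧
  P.r = R.r ∧ e P.s = R.s ∧ e P.t = R.t ∧
  ∀ a, R.β (e a) ≤ P.γ a ∧ P.γ a ≤ R.δ (e a)

/-- `e` is an isomorphism that preserves the orientation. -/
def Pass.OrientationObeysVia {U V : Type} [Fintype U] [Fintype V] (P : Pass U) (R : Rule V)
    (e : U ≃ V) : Prop :=
  P.MatchesVia R e ∧ ∀ a b c, P.tri a b c ↔ R.tri (e a) (e b) (e c)

/-- `e` is an isomorphism that reverses the orientation. -/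
def Pass.AntiOrientationObeysVia {U V : Type} [Fintype U] [Fintype V] (P : Pass U) (R : Rule V)
    (e : U ≃ V) : Prop :=
  P.MatchesVia R e ∧ ∀ a b c, P.tri a b c ↔ R.tri (e c) (e b) (e a)

/-- `P` orientation-obeys `R`; this is also written `P ≈ {R}`. -/
def Pass.OrientationObeys {U V : Type} [Fintype U] [Fintype V] (P : Pass U) (R : Rule V) : Prop :=
  ∃ e : U ≃ V, P.OrientationObeysVia R e

/-- `P` anti-orientation-obeys `R`. -/
def Pass.AntiOrientationObeys {U V : Type} [Fintype U] [Fintype V] (P : Pass U) (R : Rule V) :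
    Prop :=
  ∃ e : U ≃ V, P.AntiOrientationObeysVia R e

/-! ## Cartwheels -/

/-- The names of the vertices of cartwheels with hub of degree `d`. Spokes are named clockwise,
`hat i` is the hat adjacent to `spoke i` and `spoke (i + 1)`, and `fan i 2, fan i 3, …` are,
clockwise, the fan vertices over `spoke i`. -/
inductive Site (d : ℕ) : Type where
  | hub : Site d
  | spoke (i : ZMod d) : Site d
  | hat (i : ZMod d) : Site d
  | fan (i : ZMod d) (j : ℕ) : Site d

/-- The number of a vertex: the hub is `0`, the spokes are `1, …, d`, the hats `d + 1, …, 2d`, and the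
fan vertices over the spoke `x` are `2d + x, 3d + x, …`. -/
def Site.num {d : ℕ} : Site d → ℕ
  | .hub => 0
  | .spoke i => i.val + 1
  | .hat i => d + (i.val + 1)
  | .fan i j => j * d + (i.val + 1)

/-- The spoke with number `x`, for `1 ≤ x ≤ d`. -/
def spokeNo (d x : ℕ) : Site d := .spoke ((x - 1 : ℕ) : ZMod d)

/-- A cartwheel with hub of degree `d ≥ 5` whose vertices are named as above. Its drawing is
determined by the values of `γ` at the spokes, which are the degrees of the spokes. -/
structure Cartwheel (d : ℕ) where
  five_le_d : 5 ≤ d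
  γ : Site d → ℕ
  γ_hub : γ .hub = d
  five_le_γ : ∀ v, 5 ≤ γ v

/-- The vertices of a cartwheel: the hub, the spokes and the hats, and over a spoke of degree `k` the
`k - 5` fan vertices `fan i 2, …, fan i (k - 4)`. Values of `γ` at other names are irrelevant. -/
def Cartwheel.IsVertex {d : ℕ} (W : Cartwheel d) : Site d → Prop
  | .fan i j => 2 ≤ j ∧ j + 4 ≤ W.γ (.spoke i)
  | _ => True

/-- The neighbours of `spoke i` on the outer circuit are, in clockwise order around `spoke i`,
`rim i 1 = hat (i - 1)`, then `rim i j = fan i j` for `2 ≤ j ≤ k - 4`, and last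
`rim i (k - 3) = hat i`, where `k` is the degree of `spoke i`. -/
def Cartwheel.rim {d : ℕ} (W : Cartwheel d) (i : ZMod d) (j : ℕ) : Site d :=
  if j ≤ 1 then .hat (i - 1) else if j + 4 ≤ W.γ (.spoke i) then .fan i j else .hat i

/-- The finite regions of a cartwheel, each listed once, with its vertices in clockwise order. -/
inductive Cartwheel.Region {d : ℕ} (W : Cartwheel d) : Site d → Site d → Site d → Prop where
  | inner (i : ZMod d) : Region W .hub (.spoke i) (.spoke (i + 1))
  | middle (i : ZMod d) : Region W (.spoke i) (.hat i) (.spoke (i + 1))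
  | outer (i : ZMod d) (j : ℕ) (h1 : 1 ≤ j) (h2 : j + 4 ≤ W.γ (.spoke i)) :
      Region W (.spoke i) (W.rim i j) (W.rim i (j + 1))

/-- `a, b, c` are, in clockwise order, the vertices of a finite region. -/
def Cartwheel.tri {d : ℕ} (W : Cartwheel d) (a b c : Site d) : Prop :=
  W.Region a b c ∨ W.Region b c a ∨ W.Region c a b

/-- Adjacency in a cartwheel; every edge lies on the boundary of a finite region. -/
def Cartwheel.Adj {d : ℕ} (W : Cartwheel d) (a b : Site d) : Prop :=
  ∃ c, W.tri a b c ∨ W.tri b a c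

/-- The pass `P` with vertex set `S` appears in `W`: it is an induced subdrawing of `W`, its finite
regions are finite regions of `W`, and its `γ` is the restriction of the one of `W`. -/
def Pass.AppearsIn {d : ℕ} {S : Finset (Site d)} (P : Pass S) (W : Cartwheel d) : Prop :=
  (∀ v : S, W.IsVertex v) ∧
  (∀ a b : S, P.graph.Adj a b ↔ W.Adj a b) ∧
  (∀ a b c : S, P.tri a b c ↔ W.tri a b c) ∧
  ∀ v : S, P.γ v = W.γ v

/-- Some pass `P ≈ {R}` with source `v` and sink `w` appears in the cartwheel `W`. -/
def Rule.HasPass {V : Type} [Fintype V] (R : Rule V) {d : ℕ} (W : Cartwheel d) (v w : Site d) :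
    Prop :=
  ∃ (S : Finset (Site d)) (P : Pass S),
    P.OrientationObeys R ∧ P.AppearsIn W ∧ (P.s : Site d) = v ∧ (P.t : Site d) = w

/-- A rule is coherent if (i) whenever a pass obeying it appears in a cartwheel with source or sink at
the hub and contains a fan vertex, it also contains the spoke below, and the degree of this spoke is
fixed by the rule; and (ii) if some pass both orientation-obeys and anti-orientation-obeys the
rule, then every pass that orientation-obeys it also anti-orientation-obeys it. -/
def Rule.Coherent {V : Type} [Fintype V] (R : Rule V) : Prop :=
  (∀ (d : ℕ) (W : Cartwheel d) (S : Finset (Site d)) (P : Pass S) (e : S ≃ V),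
    P.OrientationObeysVia R e ∨ P.AntiOrientationObeysVia R e →
    P.AppearsIn W → ((P.s : Site d) = .hub ∨ (P.t : Site d) = .hub) →
    ∀ (i : ZMod d) (j : ℕ), Site.fan i j ∈ S →
      ∃ h : Site.spoke i ∈ S, R.β (e ⟨.spoke i, h⟩) = R.δ (e ⟨.spoke i, h⟩)) ∧
  ((∃ (U : Type) (_ : Fintype U) (P : Pass U), P.OrientationObeys R ∧ P.AntiOrientationObeys R) →
    ∀ (U : Type) (_ : Fintype U) (P : Pass U), P.OrientationObeys R → P.AntiOrientationObeys R)

/-- The bounds of the rule are lower bounds in `{5, …, 9}` and upper bounds in `{5, 6, 7, 8, 12}`. -/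
def Rule.Limited {V : Type} [Fintype V] (R : Rule V) : Prop :=
  ∀ v, R.β v ∈ ({5, 6, 7, 8, 9} : Set ℕ) ∧ R.δ v ∈ ({5, 6, 7, 8, 12} : Set ℕ)

/-! ## Axles and outlets -/

/-- An axle of degree `d`; only the values of `l` and `u` at `1, …, 5d` matter. -/
structure Axle (d : ℕ) where
  l : ℕ → ℕ
  u : ℕ → ℕ
  l_le_u : ∀ i, 1 ≤ i → i ≤ 5 * d → l i ≤ u i
  l_mem : ∀ i, 1 ≤ i → i ≤ 5 * d → l i ∈ ({5, 6, 7, 8, 9} : Set ℕ)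
  u_mem : ∀ i, 1 ≤ i → i ≤ 5 * d → u i ∈ ({5, 6, 7, 8, 12} : Set ℕ)
  fan_trivial : ∀ i, 1 ≤ i → i ≤ d → l i ≠ u i →
    ∀ j ∈ ({2, 3, 4} : Set ℕ), l (j * d + i) = 5 ∧ u (j * d + i) = 12

/-- The cartwheel `W` is compatible with the axle `A`: the bounds of `A` hold at all spokes and hats,
and at the fan vertices over those spokes whose degree is fixed by `A`. -/
def Cartwheel.Compatible {d : ℕ} (W : Cartwheel d) (A : Axle d) : Prop :=
  (∀ i : ZMod d, A.l (Site.spoke i).num ≤ W.γ (.spoke i) ∧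
    W.γ (.spoke i) ≤ A.u (Site.spoke i).num) ∧
  (∀ i : ZMod d, A.l (Site.hat i).num ≤ W.γ (.hat i) ∧ W.γ (.hat i) ≤ A.u (Site.hat i).num) ∧
  ∀ i : ZMod d, A.l (Site.spoke i).num = A.u (Site.spoke i).num →
    ∀ j, 2 ≤ j → j + 4 ≤ A.l (Site.spoke i).num →
      A.l (Site.fan i j).num ≤ W.γ (.fan i j) ∧ W.γ (.fan i j) ≤ A.u (Site.fan i j).num

/-- An outlet `(M, r)` of degree `d`; the elements of `M` are triples `(p, l, u)`. -/
structure Outlet (d : ℕ) where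
  M : Finset (ℕ × ℕ × ℕ)
  value : ℤ
  value_ne_zero : value ≠ 0
  p_mem : ∀ p l u, (p, l, u) ∈ M → 1 ≤ p ∧ p ≤ 5 * d
  l_le_u : ∀ p l u, (p, l, u) ∈ M → l ≤ u
  bounds_mem : ∀ p l u, (p, l, u) ∈ M →
    l ∈ ({5, 6, 7, 8, 9} : Set ℕ) ∧ u ∈ ({5, 6, 7, 8, 12} : Set ℕ)
  fan_fixed : ∀ p l u, (p, l, u) ∈ M → ∀ j ∈ ({2, 3, 4} : Set ℕ), ∀ i, 1 ≤ i → i ≤ d →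
    p = j * d + i → ∃ k, (i, k, k) ∈ M ∧ j + 4 ≤ k

/-- The outlet is reduced. -/
def Outlet.Reduced {d : ℕ} (T : Outlet d) : Prop :=
  (∀ p l u l' u', (p, l, u) ∈ T.M → (p, l', u') ∈ T.M → l = l' ∧ u = u') ∧
  ∀ p, (p, 5, 12) ∉ T.M

/-- The operation `i ⊕_d x`. -/
def oplus (d i x : ℕ) : ℕ := if x + (i - 1) % d < d then i + x else i + x - d

/-- The positioned outlet `(T, x)` is enforced by `A`. -/
def Outlet.EnforcedAt {d : ℕ} (T : Outlet d) (x : ℕ) (A : Axle d) : Prop :=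
  ∀ p l u, (p, l, u) ∈ T.M →
    l ≤ A.l (oplus d p (x - 1)) ∧ A.l (oplus d p (x - 1)) ≤ A.u (oplus d p (x - 1)) ∧
      A.u (oplus d p (x - 1)) ≤ u

/-- The positioned outlet `(T, x)` is permitted by `A`. -/
def Outlet.PermittedAt {d : ℕ} (T : Outlet d) (x : ℕ) (A : Axle d) : Prop :=
  ∀ p l u, (p, l, u) ∈ T.M →
    A.l (oplus d p (x - 1)) ≤ u ∧ l ≤ A.u (oplus d p (x - 1))

/-! A pass `P ≈ {R}` in a cartwheel is the image of an embedding `φ` of the drawing of `R` into the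
set of vertex names (`Rule.hasPass_iff`). The names are the same for all cartwheels with hub of
degree `d`, and the drawing depends only on the degrees of the spokes, so embeddings into different
cartwheels can be compared.

Embeddings are rigid (`Rule.Embeds.unique`). A region is determined by one of its edges unless a fan
vertex over a spoke of varying degree is involved, and coherence fixes the degree of every spoke
below a fan vertex of the pass. So if one of source and sink lies at the hub and the other at a
spoke, `φ` is determined up to rotation.

For this `φ`, being an embedding amounts to one interval for each degree (`Rule.Embeds.holdIn`,
`Rule.Embeds.of_holdIn`). The intervals come from `β` and `δ`, with one correction: two consecutive
hats are adjacent exactly if the spoke between them has degree five, so if both hats are in the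
pass, the interval of that spoke shrinks to 5 or starts at 6 or above. Counting neighbours shows
that the comparison of `γ` with the degree in the drawing then carries over.

The non-trivial intervals are the triples of the outlet. It is enforced if the intervals of the axle
lie inside them, and permitted if they meet (`SiteBounds.enforced_iff`, `SiteBounds.permitted_iff`).
It is unique because a reduced outlet can be recovered from the axle that has its triples as bounds
(`Outlet.eq_of_enforcedAt_iff`). Conversely, every outlet is permitted by the unrestricted axle, so
an outlet with the stated properties yields a pass. -/

/-! ## Passes as embeddings of rules into cartwheels -/

/-- The transport of a near-triangulation along a bijection. -/
def NearTriangulation.comap {U V : Type} [Fintype U] [Fintype V] (G : NearTriangulation V)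
    (e : U ≃ V) : NearTriangulation U where
  graph := G.graph.comap e
  tri a b c := G.tri (e a) (e b) (e c)
  tri_rotate _ _ _ h := G.tri_rotate _ _ _ h
  tri_adj _ _ _ h := G.tri_adj _ _ _ h
  tri_unique _ _ _ _ h h' := e.injective (G.tri_unique _ _ _ _ h h')
  connected := (SimpleGraph.Iso.comap e G.graph).connected_iff.2 G.connected
  link_connected v a b ha hb := by
    have key : ∀ x y, Relation.EqvGen (fun x y => G.tri (e v) x y) x y →
        Relation.EqvGen (fun x y => G.tri (e v) (e x) (e y)) (e.symm x) (e.symm y) := by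
      intro x y h
      induction h with
      | rel x y h => exact .rel _ _ (by simpa using h)
      | refl x => exact .refl _
      | symm x y _ ih => exact .symm _ _ ih
      | trans x y z _ _ ih ih' => exact .trans _ _ _ ih ih'
    simpa using key _ _ (G.link_connected (e v) (e a) (e b) ha hb)
  euler := by
    have h1 : {p : U × U × U | G.tri (e p.1) (e p.2.1) (e p.2.2)}.ncard
        = {p : V × V × V | G.tri p.1 p.2.1 p.2.2}.ncard := by
      refine Set.ncard_congr' ?_
      exact (Equiv.prodCongr e (Equiv.prodCongr e e)).subtypeEquiv (by intro p; rfl)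
    have h2 : (G.graph.comap e).edgeSet.ncard = G.graph.edgeSet.ncard :=
      Set.ncard_congr' (SimpleGraph.Iso.comap e G.graph).mapEdgeSet
    rw [h1, h2, Fintype.card_congr e]
    exact G.euler

theorem NearTriangulation.interior_congr {U V : Type} [Fintype U] [Fintype V]
    {H : NearTriangulation U} {G : NearTriangulation V} (e : U ≃ V)
    (hadj : ∀ a b, H.graph.Adj a b ↔ G.graph.Adj (e a) (e b))
    (htri : ∀ a b c, H.tri a b c ↔ G.tri (e a) (e b) (e c)) (v : U) :
    H.Interior v ↔ G.Interior (e v) := by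
  constructor
  · intro h a ha
    obtain ⟨b, hb⟩ := h (e.symm a) ((hadj _ _).2 (by simpa using ha))
    exact ⟨e b, by simpa using (htri _ _ _).1 hb⟩
  · intro h a ha
    obtain ⟨b, hb⟩ := h (e a) ((hadj _ _).1 ha)
    exact ⟨e.symm b, (htri _ _ _).2 (by simpa using hb)⟩

theorem SimpleGraph.ncard_neighborSet_congr {U V : Type} {H : SimpleGraph U} {G : SimpleGraph V}
    (e : U ≃ V) (hadj : ∀ a b, H.Adj a b ↔ G.Adj (e a) (e b)) (v : U) :
    (H.neighborSet v).ncard = (G.neighborSet (e v)).ncard :=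
  Set.ncard_congr' (e.subtypeEquiv fun w => hadj v w)

/-- `φ` embeds the drawing of the rule `R` into the cartwheel `W` in such a way that its image is a
pass which orientation-obeys `R`. -/
structure Rule.Embeds {V : Type} [Fintype V] (R : Rule V) {d : ℕ} (W : Cartwheel d)
    (φ : V → Site d) : Prop where
  inj : Function.Injective φ
  isVertex : ∀ v, W.IsVertex (φ v)
  adj : ∀ a b, R.graph.Adj a b ↔ W.Adj (φ a) (φ b)
  tri : ∀ a b c, R.tri a b c ↔ W.tri (φ a) (φ b) (φ c)
  le_γ : ∀ v, R.β v ≤ W.γ (φ v)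
  γ_le : ∀ v, W.γ (φ v) ≤ R.δ v
  interior : ∀ v, R.Interior v → W.γ (φ v) = (R.graph.neighborSet v).ncard
  boundary : ∀ v, ¬ R.Interior v → (R.graph.neighborSet v).ncard < W.γ (φ v)

/-- A pass in a cartwheel that orientation-obeys a rule yields an embedding of the rule. -/
theorem Pass.OrientationObeysVia.embeds {V : Type} [Fintype V] {R : Rule V} {d : ℕ}
    {W : Cartwheel d} {S : Finset (Site d)} {P : Pass S} {e : S ≃ V}
    (h : P.OrientationObeysVia R e) (hW : P.AppearsIn W) :
    R.Embeds W (fun v => (e.symm v : Site d)) := by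
  obtain ⟨⟨hadj, -, -, -, hγ⟩, htri⟩ := h
  obtain ⟨wv, wadj, wtri, wγ⟩ := hW
  have hint : ∀ v, P.Interior (e.symm v) ↔ R.Interior v := fun v => by
    simpa using NearTriangulation.interior_congr (H := P.toNearTriangulation)
      (G := R.toNearTriangulation) e hadj htri (e.symm v)
  have hdeg : ∀ v, (P.graph.neighborSet (e.symm v)).ncard = (R.graph.neighborSet v).ncard :=
    fun v => by simpa using SimpleGraph.ncard_neighborSet_congr e hadj (e.symm v)
  refine ⟨Subtype.val_injective.comp e.symm.injective, fun v => wv _, fun a b => ?_,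
    fun a b c => ?_, fun v => ?_, fun v => ?_, fun v hv => ?_, fun v hv => ?_⟩
  · rw [← wadj, hadj]; simp
  · rw [← wtri, htri]; simp
  · rw [← wγ]; simpa using (hγ (e.symm v)).1
  · rw [← wγ]; simpa using (hγ (e.symm v)).2
  · rw [← wγ, P.γ_interior _ ((hint v).2 hv), hdeg]
  · rw [← wγ, ← hdeg]; exact P.γ_boundary _ (fun h => hv ((hint v).1 h))

/-- The image of an embedding of a rule is a pass that orientation-obeys the rule. -/
theorem Rule.Embeds.exists_pass {V : Type} [Fintype V] {R : Rule V} {d : ℕ} {W : Cartwheel d}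
    {φ : V → Site d} (h : R.Embeds W φ) :
    ∃ (S : Finset (Site d)) (P : Pass S) (e : S ≃ V), P.OrientationObeysVia R e ∧ P.AppearsIn W ∧
      (P.s : Site d) = φ R.s ∧ (P.t : Site d) = φ R.t ∧ ∀ v, (e.symm v : Site d) = φ v := by
  classical
  let S : Finset (Site d) := Finset.univ.image φ
  let f : V ≃ S := Equiv.ofBijective (fun v => ⟨φ v, Finset.mem_image_of_mem _ (Finset.mem_univ v)⟩)
    ⟨fun a b hab => h.inj (congrArg Subtype.val hab), fun ⟨x, hx⟩ => by
      obtain ⟨v, -, hv⟩ := Finset.mem_image.1 hx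
      exact ⟨v, Subtype.ext hv⟩⟩
  have hf : ∀ v, (f v : Site d) = φ v := fun v => rfl
  have hf' : ∀ u : S, φ (f.symm u) = u := fun u => by rw [← hf]; simp
  have hint := fun u => NearTriangulation.interior_congr
    (H := R.toNearTriangulation.comap f.symm) (G := R.toNearTriangulation) f.symm
    (fun _ _ => Iff.rfl) (fun _ _ _ => Iff.rfl) u
  have hdeg := fun u => SimpleGraph.ncard_neighborSet_congr
    (H := (R.toNearTriangulation.comap f.symm).graph) (G := R.graph) f.symm
    (fun _ _ => Iff.rfl) u
  let P : Pass S :=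
    { R.toNearTriangulation.comap f.symm with
      γ := fun u => W.γ u
      γ_interior := fun u hu => by
        have := h.interior _ ((hint u).1 hu)
        rw [hf'] at this
        exact this.trans (hdeg u).symm
      γ_boundary := fun u hu => by
        have := h.boundary _ (fun hh => hu ((hint u).2 hh))
        rw [hf'] at this
        exact (hdeg u).trans_lt this
      five_le_γ := fun u => W.five_le_γ u
      r := R.r
      s := f R.s
      t := f R.t
      r_pos := R.r_pos
      adj_st := by
        change R.graph.Adj (f.symm (f R.s)) (f.symm (f R.t))
        simpa using R.adj_st
      near_s := fun u => by
        rcases R.near_s (f.symm u) with h | h | ⟨w, h1, h2, -⟩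
        · exact .inl (by rw [← h]; simp)
        · refine .inr (.inl ?_)
          change R.graph.Adj (f.symm u) (f.symm (f R.s))
          simpa using h
        · refine .inr (.inr ⟨f w, ?_, ?_⟩)
          · change R.graph.Adj (f.symm u) (f.symm (f w))
            simpa using h1
          · change R.graph.Adj (f.symm (f w)) (f.symm (f R.s))
            simpa using h2
      near_t := fun u => by
        rcases R.near_t (f.symm u) with h | h | ⟨w, h1, h2, -⟩
        · exact .inl (by rw [← h]; simp)
        · refine .inr (.inl ?_)
          change R.graph.Adj (f.symm u) (f.symm (f R.t))
          simpa using h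
        · refine .inr (.inr ⟨f w, ?_, ?_⟩)
          · change R.graph.Adj (f.symm u) (f.symm (f w))
            simpa using h1
          · change R.graph.Adj (f.symm (f w)) (f.symm (f R.t))
            simpa using h2 }
  refine ⟨S, P, f.symm, ⟨⟨fun a b => Iff.rfl, rfl, f.symm_apply_apply _, f.symm_apply_apply _,
    fun u => ?_⟩, fun a b c => Iff.rfl⟩, ⟨fun u => ?_, fun a b => ?_, fun a b c => ?_, fun u => rfl⟩,
    rfl, rfl, fun v => rfl⟩
  · have h1 := h.le_γ (f.symm u)
    have h2 := h.γ_le (f.symm u)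
    rw [hf'] at h1 h2
    exact ⟨h1, h2⟩
  · have := h.isVertex (f.symm u)
    rwa [hf'] at this
  · have := h.adj (f.symm a) (f.symm b)
    rwa [hf', hf'] at this
  · have := h.tri (f.symm a) (f.symm b) (f.symm c)
    rwa [hf', hf', hf'] at this

/-- Replaces a pass, which has a vertex set of its own, by a map on the fixed vertex set of `R`.
From here on only embeddings are used. -/
theorem Rule.hasPass_iff {V : Type} [Fintype V] (R : Rule V) {d : ℕ} (W : Cartwheel d)
    (v w : Site d) : R.HasPass W v w ↔ ∃ φ, R.Embeds W φ ∧ φ R.s = v ∧ φ R.t = w := by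
  constructor
  · rintro ⟨S, P, ⟨e, he⟩, hW, rfl, rfl⟩
    refine ⟨_, he.embeds hW, ?_, ?_⟩
    · simp [← he.1.2.2.1]
    · simp [← he.1.2.2.2.1]
  · rintro ⟨φ, hφ, rfl, rfl⟩
    obtain ⟨S, P, e, he, hW, hs, ht, -⟩ := hφ.exists_pass
    exact ⟨S, P, ⟨e, he⟩, hW, hs, ht⟩

/-- Coherence, in terms of embeddings. -/
theorem Rule.Coherent.exists_spoke {V : Type} [Fintype V] {R : Rule V} (hR : R.Coherent) {d : ℕ}
    {W : Cartwheel d} {φ : V → Site d} (h : R.Embeds W φ) (hub : φ R.s = .hub ∨ φ R.t = .hub)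
    {v : V} {i : ZMod d} {j : ℕ} (hv : φ v = .fan i j) :
    ∃ u, φ u = .spoke i ∧ R.β u = R.δ u := by
  obtain ⟨S, P, e, he, hW, hs, ht, hφ⟩ := h.exists_pass
  obtain ⟨hm, hβ⟩ := hR.1 d W S P e (.inl he) hW (by rwa [hs, ht]) i j
    (by rw [← hv, ← hφ]; exact (e.symm v).2)
  exact ⟨_, by rw [← hφ]; simp, hβ⟩

/-! ## The combinatorics of cartwheels -/

/-- The finite regions of a cartwheel, with the vertices of the outer circuit named explicitly. -/
inductive Cartwheel.Face {d : ℕ} (W : Cartwheel d) : Site d → Site d → Site d → Prop where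
  | inner (i i' : ZMod d) (h : i' = i + 1) : Face W .hub (.spoke i) (.spoke i')
  | middle (i i' : ZMod d) (h : i' = i + 1) : Face W (.spoke i) (.hat i) (.spoke i')
  | bare (i i' : ZMod d) (h : i = i' + 1) (hk : W.γ (.spoke i) = 5) :
      Face W (.spoke i) (.hat i') (.hat i)
  | first (i i' : ZMod d) (j : ℕ) (h : i = i' + 1) (hj : j = 2) (hk : 6 ≤ W.γ (.spoke i)) :
      Face W (.spoke i) (.hat i') (.fan i j)
  | mid (i : ZMod d) (j j' : ℕ) (h : j' = j + 1) (hj : 2 ≤ j) (hk : j + 5 ≤ W.γ (.spoke i)) :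
      Face W (.spoke i) (.fan i j) (.fan i j')
  | last (i : ZMod d) (j : ℕ) (hj : 2 ≤ j) (hk : W.γ (.spoke i) = j + 4) :
      Face W (.spoke i) (.fan i j) (.hat i)

/-- The regions over a spoke are sorted by which of `rim i j`, `rim i (j + 1)` are hats. Index
relations are hypotheses in `Face`, so that case analysis works for arbitrary indices. -/
theorem Cartwheel.region_iff {d : ℕ} (W : Cartwheel d) (a b c : Site d) :
    W.Region a b c ↔ W.Face a b c := by
  constructor
  · rintro (i | i | ⟨i, j, h1, h2⟩)
    · exact .inner _ _ rfl
    · exact .middle _ _ rfl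
    · unfold Cartwheel.rim
      have := W.five_le_γ (.spoke i)
      split_ifs with h3 h4 h5 h6
      · omega
      · exact .first _ _ _ (by ring) (by omega) (by omega)
      · exact .bare _ _ (by ring) (by omega)
      · omega
      · exact .mid _ _ _ rfl (by omega) (by omega)
      · exact .last _ _ (by omega) (by omega)
  · rintro (⟨i, i', rfl⟩ | ⟨i, i', rfl⟩ | ⟨i, i', h, hk⟩ | ⟨i, i', j, h, rfl, hk⟩ |
      ⟨i, j, j', rfl, hj, hk⟩ | ⟨i, j, hj, hk⟩)
    · exact .inner _
    · exact .middle _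
    · obtain rfl := eq_sub_of_add_eq h.symm
      have := Region.outer (W := W) i 1 le_rfl (by omega)
      simpa [Cartwheel.rim, hk] using this
    · obtain rfl := eq_sub_of_add_eq h.symm
      have := Region.outer (W := W) i 1 le_rfl (by omega)
      simpa [Cartwheel.rim, hk] using this
    · have := Region.outer (W := W) i j (by omega) (by omega)
      rwa [Cartwheel.rim, if_neg (by omega), if_pos (by omega), Cartwheel.rim, if_neg (by omega),
        if_pos (by omega)] at this
    · have := Region.outer (W := W) i j (by omega) (by omega)
      rwa [Cartwheel.rim, if_neg (by omega), if_pos (by omega), Cartwheel.rim, if_neg (by omega),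
        if_neg (by omega)] at this

theorem Cartwheel.tri_iff {d : ℕ} (W : Cartwheel d) (a b c : Site d) :
    W.tri a b c ↔ W.Face a b c ∨ W.Face b c a ∨ W.Face c a b := by
  simp only [Cartwheel.tri, Cartwheel.region_iff]

/-- The edges of a cartwheel, each listed once. -/
inductive Cartwheel.Edge {d : ℕ} (W : Cartwheel d) : Site d → Site d → Prop where
  | hub (i : ZMod d) : Edge W .hub (.spoke i)
  | spokes (i i' : ZMod d) (h : i' = i + 1) : Edge W (.spoke i) (.spoke i')
  | hat (i : ZMod d) : Edge W (.spoke i) (.hat i)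
  | hat' (i i' : ZMod d) (h : i = i' + 1) : Edge W (.spoke i) (.hat i')
  | fan (i : ZMod d) (j : ℕ) (hj : 2 ≤ j) (hk : j + 4 ≤ W.γ (.spoke i)) :
      Edge W (.spoke i) (.fan i j)
  | bare (i i' : ZMod d) (h : i = i' + 1) (hk : W.γ (.spoke i) = 5) : Edge W (.hat i') (.hat i)
  | first (i i' : ZMod d) (j : ℕ) (h : i = i' + 1) (hj : j = 2) (hk : 6 ≤ W.γ (.spoke i)) :
      Edge W (.hat i') (.fan i j)
  | mid (i : ZMod d) (j j' : ℕ) (h : j' = j + 1) (hj : 2 ≤ j) (hk : j + 5 ≤ W.γ (.spoke i)) :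
      Edge W (.fan i j) (.fan i j')
  | last (i : ZMod d) (j : ℕ) (hj : 2 ≤ j) (hk : W.γ (.spoke i) = j + 4) :
      Edge W (.fan i j) (.hat i)

theorem Cartwheel.Face.edges {d : ℕ} {W : Cartwheel d} {a b c : Site d} (h : W.Face a b c) :
    (W.Edge a b ∨ W.Edge b a) ∧ (W.Edge b c ∨ W.Edge c b) ∧ (W.Edge c a ∨ W.Edge a c) := by
  rcases h with ⟨i, i', h⟩ | ⟨i, i', h⟩ | ⟨i, i', h, hk⟩ | ⟨i, i', j, h, hj, hk⟩ |
      ⟨i, j, j', h, hj, hk⟩ | ⟨i, j, hj, hk⟩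
  · exact ⟨.inl (.hub _), .inl (.spokes _ _ h), .inr (.hub _)⟩
  · exact ⟨.inl (.hat _), .inr (.hat' _ _ h), .inr (.spokes _ _ h)⟩
  · exact ⟨.inl (.hat' _ _ h), .inl (.bare _ _ h hk), .inr (.hat _)⟩
  · exact ⟨.inl (.hat' _ _ h), .inl (.first _ _ _ h hj hk), .inr (.fan _ _ (by omega) (by omega))⟩
  · exact ⟨.inl (.fan _ _ hj (by omega)), .inl (.mid _ _ _ h hj hk),
      .inr (.fan _ _ (by omega) (by omega))⟩
  · exact ⟨.inl (.fan _ _ hj (by omega)), .inl (.last _ _ hj hk), .inr (.hat _)⟩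

theorem Cartwheel.Edge.exists_tri {d : ℕ} {W : Cartwheel d} {a b : Site d} (h : W.Edge a b) :
    ∃ c, W.tri a b c ∨ W.tri b a c := by
  simp only [Cartwheel.tri_iff]
  rcases h with i | ⟨i, i', h⟩ | i | ⟨i, i', h⟩ | ⟨i, j, hj, hk⟩ | ⟨i, i', h, hk⟩ |
      ⟨i, i', j, h, hj, hk⟩ | ⟨i, j, j', h, hj, hk⟩ | ⟨i, j, hj, hk⟩
  · exact ⟨_, .inl (.inl (.inner i _ rfl))⟩
  · exact ⟨_, .inl (.inr (.inr (.inner i _ h)))⟩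
  · exact ⟨_, .inl (.inl (.middle i _ rfl))⟩
  · exact ⟨_, .inr (.inr (.inr (.middle i' i h)))⟩
  · rcases hk.eq_or_lt with hk | hk
    · exact ⟨_, .inl (.inl (.last i j hj hk.symm))⟩
    · exact ⟨_, .inl (.inl (.mid i j _ rfl hj (by omega)))⟩
  · exact ⟨_, .inl (.inr (.inr (.bare i i' h hk)))⟩
  · exact ⟨_, .inl (.inr (.inr (.first i i' j h hj hk)))⟩
  · exact ⟨_, .inl (.inr (.inr (.mid i j j' h hj hk)))⟩
  · exact ⟨_, .inl (.inr (.inr (.last i j hj hk)))⟩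

theorem Cartwheel.adj_iff {d : ℕ} (W : Cartwheel d) (a b : Site d) :
    W.Adj a b ↔ W.Edge a b ∨ W.Edge b a := by
  constructor
  · rintro ⟨c, h | h⟩ <;> rcases (W.tri_iff _ _ _).1 h with h | h | h <;>
      have := h.edges <;> tauto
  · rintro (h | h)
    · exact h.exists_tri
    · obtain ⟨c, hc⟩ := h.exists_tri
      exact ⟨c, hc.symm⟩

theorem ZMod.two_ne_zero_of_five_le {d : ℕ} (hd : 5 ≤ d) : (1 + 1 : ZMod d) ≠ 0 := by
  intro h
  have : ((2 : ℕ) : ZMod d) = 0 := by push_cast; rw [← h]; norm_num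
  have := Nat.le_of_dvd (by norm_num) ((ZMod.natCast_eq_zero_iff _ _).1 this)
  omega

theorem ZMod.add_one_ne {d : ℕ} (hd : 5 ≤ d) (i : ZMod d) : i + 1 ≠ i := by
  intro h
  have h1 : (1 : ZMod d) = 0 := by simpa using h
  exact ZMod.two_ne_zero_of_five_le hd (by rw [h1, add_zero])

theorem ZMod.add_one_add_one_ne {d : ℕ} (hd : 5 ≤ d) (i : ZMod d) : i + 1 + 1 ≠ i := by
  intro h
  exact ZMod.two_ne_zero_of_five_le hd (by simpa [add_assoc] using h)

/-- Two hats are adjacent if and only if they are consecutive and the spoke between them has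
degree five. -/
theorem Cartwheel.adj_hat_iff {d : ℕ} (W : Cartwheel d) (i : ZMod d) :
    W.Adj (.hat (i - 1)) (.hat i) ↔ W.γ (.spoke i) = 5 := by
  rw [W.adj_iff]
  constructor
  · rintro (h | h)
    · cases h with
      | bare _ _ h hk => exact hk
    · cases h with
      | bare _ _ h hk =>
        -- Traversed in this direction, the edge would require `i - 1 = i + 1`.
        exfalso
        refine ZMod.add_one_add_one_ne W.five_le_d i ?_
        rw [← h]; ring
  · exact fun h => .inl (.bare _ _ (by ring) h)

/-- The third vertex of a finite region of a cartwheel is determined by the other two, and by the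
degree of the spoke among them if it may be a fan vertex. -/
theorem Cartwheel.third_vertex {d : ℕ} {W W' : Cartwheel d} {a b c c' : Site d}
    (h : W.tri a b c) (h' : W'.tri a b c') :
    c = c' ∨ ∃ i, (a = .spoke i ∨ b = .spoke i) ∧ W.γ (.spoke i) ≠ W'.γ (.spoke i) ∧
      ∃ j, c = .fan i j ∨ c' = .fan i j := by
  -- These exclude that going one or two spokes further returns to the same spoke, the only way in
  -- which differently shaped regions could share a directed edge.
  have e1 := ZMod.add_one_ne W.five_le_d
  have e2 := ZMod.add_one_add_one_ne W.five_le_d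
  rw [Cartwheel.tri_iff] at h h'
  rcases h with h | h | h <;> cases h <;> rcases h' with h' | h' | h' <;> cases h' <;> grind

/-! ## Embeddings of a coherent rule are rigid -/

/-- Two embeddings of a coherent rule, possibly into different cartwheels, coincide if they agree at
the source and the sink, one of which is mapped to the hub. -/
theorem Rule.Embeds.unique {V : Type} [Fintype V] {R : Rule V} (hR : R.Coherent) {d : ℕ}
    {W W' : Cartwheel d} {φ φ' : V → Site d} (h : R.Embeds W φ) (h' : R.Embeds W' φ')
    (hub : φ R.s = .hub ∨ φ R.t = .hub) (hs : φ R.s = φ' R.s) (ht : φ R.t = φ' R.t) : φ = φ' := by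
  -- The exceptional case of `Cartwheel.third_vertex` needs a spoke of the region with different
  -- degrees in `W` and `W'`, and a fan vertex over it. By coherence `β = δ` at that spoke, so its
  -- two degrees are equal.
  have third : ∀ a b c, R.tri a b c → φ a = φ' a → φ b = φ' b → φ c = φ' c := by
    intro a b c habc ha hb
    have h1 := (h.tri _ _ _).1 habc
    have h2 := (h'.tri _ _ _).1 habc
    rw [← ha, ← hb] at h2
    rcases Cartwheel.third_vertex h1 h2 with h3 | ⟨i, hi, hne, j, hj⟩
    · exact h3
    · exfalso
      obtain ⟨v, hv, hv'⟩ : ∃ v, φ v = .spoke i ∧ φ' v = .spoke i := by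
        rcases hi with hi | hi
        · exact ⟨a, hi, by rw [← ha, hi]⟩
        · exact ⟨b, hi, by rw [← hb, hi]⟩
      have hβ : R.β v = R.δ v := by
        rcases hj with hj | hj
        · obtain ⟨u, hu, hβ⟩ := hR.exists_spoke h hub hj
          rwa [h.inj (hv.trans hu.symm)]
        · obtain ⟨u, hu, hβ⟩ := hR.exists_spoke h' (by rwa [← hs, ← ht]) hj
          rwa [h'.inj (hv'.trans hu.symm)]
      have a1 := h.le_γ v
      have a2 := h.γ_le v
      have a3 := h'.le_γ v
      have a4 := h'.γ_le v
      rw [hv] at a1 a2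
      rw [hv'] at a3 a4
      omega
  -- Agreement spreads around `v` from region to region, in both directions because regions can be
  -- rotated.
  have link : ∀ v x y, φ v = φ' v → Relation.EqvGen (fun x y => R.tri v x y) x y →
      (φ x = φ' x ↔ φ y = φ' y) := by
    intro v x y hv hxy
    induction hxy with
    | rel x y hxy =>
      exact ⟨fun hx => third _ _ _ hxy hv hx,
        fun hy => third _ _ _ (R.tri_rotate _ _ _ (R.tri_rotate _ _ _ hxy)) hy hv⟩
    | refl x => exact Iff.rfl
    | symm x y _ ih => exact ih.symm
    | trans x y z _ _ ih ih' => exact ih.trans ih'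
  have nbrs : ∀ v w, R.graph.Adj v w → φ v = φ' v → φ w = φ' w →
      ∀ x, R.graph.Adj v x → φ x = φ' x :=
    fun v w hvw hv hw x hx => (link v w x hv (R.link_connected v w x hvw hx)).1 hw
  -- The induction carries agreement at a vertex and at all its neighbours: turning around the next
  -- vertex needs one neighbour already known to agree, and the previous vertex serves.
  have walk : ∀ u v, R.graph.Walk u v → (φ u = φ' u ∧ ∀ x, R.graph.Adj u x → φ x = φ' x) →
      φ v = φ' v := by
    intro u v p
    induction p with
    | nil => exact fun h => h.1
    | cons huv p ih =>
      exact fun h => ih ⟨h.2 _ huv, nbrs _ _ huv.symm (h.2 _ huv) h.1⟩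
  funext v
  obtain ⟨p⟩ := R.connected.preconnected R.s v
  exact walk _ _ p ⟨hs, nbrs _ _ R.adj_st hs ht⟩

/-! ## Cartwheels that agree on a set of vertices -/

/-- The drawings of the cartwheels `W` and `W'` induce the same subdrawing on the set `I`, for the
following reasons. -/
def Cartwheel.AgreeOn {d : ℕ} (W W' : Cartwheel d) (I : Set (Site d)) : Prop :=
  ∀ i, W.γ (.spoke i) = W'.γ (.spoke i) ∨ ((∀ j, Site.fan i j ∉ I) ∧
    (.hat (i - 1) ∈ I → .hat i ∈ I → 6 ≤ W.γ (.spoke i) ∧ 6 ≤ W'.γ (.spoke i)))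

theorem Cartwheel.AgreeOn.symm {d : ℕ} {W W' : Cartwheel d} {I : Set (Site d)}
    (h : W.AgreeOn W' I) : W'.AgreeOn W I := fun i =>
  (h i).imp Eq.symm fun h => ⟨h.1, fun h1 h2 => (h.2 h1 h2).symm⟩

/-- A region that depends on the degree of `spoke i` contains either a fan vertex over it or both
hats next to it; the latter happens only in degree five. `AgreeOn` rules out both where the degrees
differ. -/
theorem Cartwheel.AgreeOn.face {d : ℕ} {W W' : Cartwheel d} {I : Set (Site d)}
    (h : W.AgreeOn W' I) {a b c : Site d} (ha : a ∈ I) (hb : b ∈ I) (hc : c ∈ I)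
    (hf : W.Face a b c) : W'.Face a b c := by
  rcases hf with ⟨i, i', hi⟩ | ⟨i, i', hi⟩ | ⟨i, i', hi, hk⟩ | ⟨i, i', j, hi, hj, hk⟩ |
      ⟨i, j, j', hi, hj, hk⟩ | ⟨i, j, hj, hk⟩
  · exact .inner _ _ hi
  · exact .middle _ _ hi
  · refine .bare _ _ hi ?_
    rcases h i with h | h
    · rw [← h, hk]
    · have := h.2 (by rwa [← eq_sub_of_add_eq hi.symm]) hc
      omega
  · rcases h i with h | h
    · exact .first _ _ _ hi hj (by rwa [← h])
    · exact absurd hc (h.1 _)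
  · rcases h i with h | h
    · exact .mid _ _ _ hi hj (by rwa [← h])
    · exact absurd hc (h.1 _)
  · rcases h i with h | h
    · exact .last _ _ hj (by rwa [← h])
    · exact absurd hb (h.1 _)

theorem Cartwheel.AgreeOn.edge {d : ℕ} {W W' : Cartwheel d} {I : Set (Site d)}
    (h : W.AgreeOn W' I) {a b : Site d} (ha : a ∈ I) (hb : b ∈ I) (he : W.Edge a b) :
    W'.Edge a b := by
  rcases he with i | ⟨i, i', hi⟩ | i | ⟨i, i', hi⟩ | ⟨i, j, hj, hk⟩ | ⟨i, i', hi, hk⟩ |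
      ⟨i, i', j, hi, hj, hk⟩ | ⟨i, j, j', hi, hj, hk⟩ | ⟨i, j, hj, hk⟩
  · exact .hub _
  · exact .spokes _ _ hi
  · exact .hat _
  · exact .hat' _ _ hi
  · rcases h i with h | h
    · exact .fan _ _ hj (by rwa [← h])
    · exact absurd hb (h.1 _)
  · refine .bare _ _ hi ?_
    rcases h i with h | h
    · rw [← h, hk]
    · have := h.2 (by rwa [← eq_sub_of_add_eq hi.symm]) hb
      omega
  · rcases h i with h | h
    · exact .first _ _ _ hi hj (by rwa [← h])
    · exact absurd hb (h.1 _)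
  · rcases h i with h | h
    · exact .mid _ _ _ hi hj (by rwa [← h])
    · exact absurd hb (h.1 _)
  · rcases h i with h | h
    · exact .last _ _ hj (by rwa [← h])
    · exact absurd ha (h.1 _)

theorem Cartwheel.AgreeOn.tri_iff {d : ℕ} {W W' : Cartwheel d} {I : Set (Site d)}
    (h : W.AgreeOn W' I) {a b c : Site d} (ha : a ∈ I) (hb : b ∈ I) (hc : c ∈ I) :
    W.tri a b c ↔ W'.tri a b c := by
  rw [W.tri_iff, W'.tri_iff]
  exact ⟨.imp (h.face ha hb hc) (.imp (h.face hb hc ha) (h.face hc ha hb)),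
    .imp (h.symm.face ha hb hc) (.imp (h.symm.face hb hc ha) (h.symm.face hc ha hb))⟩

theorem Cartwheel.AgreeOn.adj_iff {d : ℕ} {W W' : Cartwheel d} {I : Set (Site d)}
    (h : W.AgreeOn W' I) {a b : Site d} (ha : a ∈ I) (hb : b ∈ I) :
    W.Adj a b ↔ W'.Adj a b := by
  rw [W.adj_iff, W'.adj_iff]
  exact ⟨.imp (h.edge ha hb) (h.edge hb ha), .imp (h.symm.edge ha hb) (h.symm.edge hb ha)⟩

/-! ## Degrees -/

theorem Cartwheel.neighbors_hat {d : ℕ} (W : Cartwheel d) (i : ZMod d) :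
    ∃ a b, ∀ x, W.Adj (.hat i) x → x ∈ ({.spoke i, .spoke (i + 1), a, b} : Set (Site d)) := by
  -- The two neighbours on the outer circuit: a hat where the spoke has degree five, otherwise the
  -- last fan vertex over `spoke i` and the first one over `spoke (i + 1)`.
  refine ⟨if W.γ (.spoke i) = 5 then .hat (i - 1) else .fan i (W.γ (.spoke i) - 4),
    if W.γ (.spoke (i + 1)) = 5 then .hat (i + 1) else .fan (i + 1) 2, fun x hx => ?_⟩
  rw [W.adj_iff] at hx
  simp only [Set.mem_insert_iff, Set.mem_singleton_iff]
  rcases hx with h | h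
  · cases h with
    | bare i₁ _ h hk => subst h; simp [hk]
    | first i₁ _ j h hj hk => subst h hj; rw [if_neg (show W.γ (.spoke (i + 1)) ≠ 5 by omega)]; simp
  · cases h with
    | hat => simp
    | hat' i₁ _ h => subst h; simp
    | bare _ i' h hk => subst h; simp [hk]
    | last _ j hj hk => rw [if_neg (show W.γ (.spoke i) ≠ 5 by omega), hk]; simp

theorem Cartwheel.neighbors_fan {d : ℕ} (W : Cartwheel d) (i : ZMod d) (j : ℕ) :
    ∀ x, W.Adj (.fan i j) x → x ∈ ({.spoke i, W.rim i (j - 1), W.rim i (j + 1)} : Set (Site d)) := by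
  intro x hx
  rw [W.adj_iff] at hx
  simp only [Set.mem_insert_iff, Set.mem_singleton_iff, Cartwheel.rim]
  rcases hx with h | h
  · cases h with
    | mid _ _ j' h hj hk =>
      subst h
      rw [if_neg (show ¬ j + 1 ≤ 1 by omega), if_pos (show j + 1 + 4 ≤ W.γ (.spoke i) by omega)]
      simp
    | last _ _ hj hk =>
      rw [if_neg (show ¬ j + 1 ≤ 1 by omega), if_neg (show ¬ j + 1 + 4 ≤ W.γ (.spoke i) by omega)]
      simp
  · cases h with
    | fan => simp
    | first _ i' _ h hj hk => subst h hj; simp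
    | mid _ j' _ h hj hk =>
      subst h
      rw [if_neg (show ¬ j' + 1 - 1 ≤ 1 by omega),
        if_pos (show j' + 1 - 1 + 4 ≤ W.γ (.spoke i) by omega)]
      simp

theorem Cartwheel.neighbors_spoke {d : ℕ} (W : Cartwheel d) (i : ZMod d) :
    ∀ x, W.Adj (.spoke i) x → (∃ j, x = .fan i j) ∨
      x ∈ ({.hub, .spoke (i - 1), .spoke (i + 1), .hat (i - 1), .hat i} : Set (Site d)) := by
  intro x hx
  rw [W.adj_iff] at hx
  simp only [Set.mem_insert_iff, Set.mem_singleton_iff]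
  rcases hx with h | h
  · cases h with
    | spokes _ _ h => simp [h]
    | hat => simp
    | hat' _ i' h => subst h; simp
    | fan _ j => exact .inl ⟨j, rfl⟩
  · cases h with
    | hub => simp
    | spokes _ _ h => subst h; simp

/-- Basis of the degree counts below, by which `γ ≥ 5`, or `γ ≥ 6` at a spoke with both hats,
already exceeds the degree in the drawing when no fan vertices over the spoke are present. -/
theorem Rule.Embeds.ncard_neighborSet_le {V : Type} [Fintype V] {R : Rule V} {d : ℕ}
    {W : Cartwheel d} {φ : V → Site d} (h : R.Embeds W φ) (v : V) (L : Finset (Site d))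
    (hL : ∀ x ∈ Set.range φ, W.Adj (φ v) x → x ∈ L) :
    (R.graph.neighborSet v).ncard ≤ L.card := by
  rw [← Set.ncard_image_of_injective _ h.inj, ← Set.ncard_coe_finset]
  refine Set.ncard_le_ncard ?_ L.finite_toSet
  rintro _ ⟨w, hw, rfl⟩
  exact hL _ ⟨w, rfl⟩ ((h.adj _ _).1 hw)

/-- The degree in the drawing of a rule of a vertex embedded as a hat is at most four. -/
theorem Rule.Embeds.ncard_hat {V : Type} [Fintype V] {R : Rule V} {d : ℕ}
    {W : Cartwheel d} {φ : V → Site d} (h : R.Embeds W φ) {v : V} {i : ZMod d}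
    (hv : φ v = .hat i) : (R.graph.neighborSet v).ncard ≤ 4 := by
  classical
  obtain ⟨a, b, hab⟩ := W.neighbors_hat i
  refine (h.ncard_neighborSet_le v {.spoke i, .spoke (i + 1), a, b} fun x _ hx => ?_).trans
    Finset.card_le_four
  rw [hv] at hx
  simpa using hab x hx

/-- The degree in the drawing of a rule of a vertex embedded as a fan vertex is at most three. -/
theorem Rule.Embeds.ncard_fan {V : Type} [Fintype V] {R : Rule V} {d : ℕ}
    {W : Cartwheel d} {φ : V → Site d} (h : R.Embeds W φ) {v : V} {i : ZMod d} {j : ℕ}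
    (hv : φ v = .fan i j) : (R.graph.neighborSet v).ncard ≤ 3 := by
  classical
  refine (h.ncard_neighborSet_le v {.spoke i, W.rim i (j - 1), W.rim i (j + 1)}
    fun x _ hx => ?_).trans Finset.card_le_three
  rw [hv] at hx
  simpa using W.neighbors_fan i j x hx

/-- The degree of a vertex embedded as a spoke without fan vertices is at most five. -/
theorem Rule.Embeds.ncard_spoke {V : Type} [Fintype V] {R : Rule V} {d : ℕ}
    {W : Cartwheel d} {φ : V → Site d} (h : R.Embeds W φ) {v : V} {i : ZMod d}
    (hv : φ v = .spoke i) (hfan : ∀ j, Site.fan i j ∉ Set.range φ) :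
    (R.graph.neighborSet v).ncard ≤ 5 := by
  classical
  refine (h.ncard_neighborSet_le v {.hub, .spoke (i - 1), .spoke (i + 1), .hat (i - 1), .hat i}
    fun x hx hadj => ?_).trans Finset.card_le_five
  rw [hv] at hadj
  rcases W.neighbors_spoke i x hadj with ⟨j, rfl⟩ | h
  · exact absurd hx (hfan j)
  · simpa using h

/-- The degree of a vertex embedded as a spoke without fan vertices is at most four if one of the
hats next to it is missing. -/
theorem Rule.Embeds.ncard_spoke' {V : Type} [Fintype V] {R : Rule V} {d : ℕ}
    {W : Cartwheel d} {φ : V → Site d} (h : R.Embeds W φ) {v : V} {i : ZMod d}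
    (hv : φ v = .spoke i) (hfan : ∀ j, Site.fan i j ∉ Set.range φ)
    (hhat : ¬ (.hat (i - 1) ∈ Set.range φ ∧ .hat i ∈ Set.range φ)) :
    (R.graph.neighborSet v).ncard ≤ 4 := by
  classical
  rcases not_and_or.1 hhat with hh | hh
  · refine (h.ncard_neighborSet_le v {.hub, .spoke (i - 1), .spoke (i + 1), .hat i}
      fun x hx hadj => ?_).trans Finset.card_le_four
    rw [hv] at hadj
    rcases W.neighbors_spoke i x hadj with ⟨j, rfl⟩ | h
    · exact absurd hx (hfan j)
    · have : x ≠ .hat (i - 1) := fun h => hh (h ▸ hx)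
      simpa [this] using h
  · refine (h.ncard_neighborSet_le v {.hub, .spoke (i - 1), .spoke (i + 1), .hat (i - 1)}
      fun x hx hadj => ?_).trans Finset.card_le_four
    rw [hv] at hadj
    rcases W.neighbors_spoke i x hadj with ⟨j, rfl⟩ | h
    · exact absurd hx (hfan j)
    · have : x ≠ .hat i := fun h => hh (h ▸ hx)
      simpa [this] using h

/-! ## Rotations -/

/-- Rotation of the names of the vertices of cartwheels. -/
def Site.shift {d : ℕ} (k : ZMod d) : Site d → Site d
  | .hub => .hub
  | .spoke i => .spoke (i + k)
  | .hat i => .hat (i + k)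
  | .fan i j => .fan (i + k) j

theorem Site.shift_shift {d : ℕ} (k l : ZMod d) (s : Site d) :
    (s.shift k).shift l = s.shift (k + l) := by
  cases s <;> simp [Site.shift, add_assoc]

theorem Site.shift_zero {d : ℕ} (s : Site d) : s.shift 0 = s := by
  cases s <;> simp [Site.shift]

theorem Site.shift_injective {d : ℕ} (k : ZMod d) : Function.Injective (Site.shift k) := by
  intro s t h
  have := congrArg (Site.shift (-k)) h
  simpa [Site.shift_shift, Site.shift_zero] using this

/-- The cartwheel `W`, with its vertices renamed. -/
def Cartwheel.rotate {d : ℕ} (W : Cartwheel d) (k : ZMod d) : Cartwheel d where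
  five_le_d := W.five_le_d
  γ s := W.γ (s.shift k)
  γ_hub := W.γ_hub
  five_le_γ _ := W.five_le_γ _

theorem Cartwheel.rotate_rotate_neg {d : ℕ} (W : Cartwheel d) (k : ZMod d) :
    (W.rotate k).rotate (-k) = W := by
  cases W
  simp [Cartwheel.rotate, Site.shift_shift, Site.shift_zero]

/-- The name `s` in `W.rotate k` denotes the vertex called `s.shift k` in `W`. -/
theorem Cartwheel.Face.of_rotate {d : ℕ} {W : Cartwheel d} {k : ZMod d} {a b c : Site d}
    (h : (W.rotate k).Face a b c) : W.Face (a.shift k) (b.shift k) (c.shift k) := by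
  rcases h with ⟨i, i', rfl⟩ | ⟨i, i', rfl⟩ | ⟨i, i', rfl, hk⟩ | ⟨i, i', j, rfl, hj, hk⟩ |
      ⟨i, j, j', hi, hj, hk⟩ | ⟨i, j, hj, hk⟩
  · exact .inner _ _ (by ring)
  · exact .middle _ _ (by ring)
  · exact .bare _ _ (by ring) hk
  · exact .first _ _ _ (by ring) hj hk
  · exact .mid _ _ _ hi hj hk
  · exact .last _ _ hj hk

theorem Cartwheel.tri_of_rotate {d : ℕ} {W : Cartwheel d} {k : ZMod d} {a b c : Site d}
    (h : (W.rotate k).tri a b c) : W.tri (a.shift k) (b.shift k) (c.shift k) := by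
  rw [Cartwheel.tri_iff] at *
  exact h.imp .of_rotate (.imp .of_rotate .of_rotate)

theorem Cartwheel.tri_rotate_iff {d : ℕ} (W : Cartwheel d) (k : ZMod d) (a b c : Site d) :
    (W.rotate k).tri a b c ↔ W.tri (a.shift k) (b.shift k) (c.shift k) := by
  refine ⟨Cartwheel.tri_of_rotate, fun h => ?_⟩
  rw [← W.rotate_rotate_neg k] at h
  simpa [Site.shift_shift, Site.shift_zero] using Cartwheel.tri_of_rotate h

theorem Cartwheel.adj_rotate_iff {d : ℕ} (W : Cartwheel d) (k : ZMod d) (a b : Site d) :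
    (W.rotate k).Adj a b ↔ W.Adj (a.shift k) (b.shift k) := by
  simp only [Cartwheel.Adj, Cartwheel.tri_rotate_iff]
  refine ⟨fun ⟨c, hc⟩ => ⟨_, hc⟩, fun ⟨c, hc⟩ => ⟨c.shift (-k), ?_⟩⟩
  simpa [Site.shift_shift, Site.shift_zero] using hc

theorem Rule.Embeds.of_rotate {V : Type} [Fintype V] {R : Rule V} {d : ℕ} {W : Cartwheel d}
    {k : ZMod d} {φ : V → Site d} (h : R.Embeds (W.rotate k) φ) :
    R.Embeds W (fun v => (φ v).shift k) where
  inj := (Site.shift_injective k).comp h.inj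
  isVertex v := by
    have := h.isVertex v
    revert this
    generalize φ v = s
    cases s <;> exact id
  adj a b := by rw [h.adj, Cartwheel.adj_rotate_iff]
  tri a b c := by rw [h.tri, Cartwheel.tri_rotate_iff]
  le_γ := h.le_γ
  γ_le := h.γ_le
  interior := h.interior
  boundary := h.boundary

theorem Rule.Embeds.rotate {V : Type} [Fintype V] {R : Rule V} {d : ℕ} {W : Cartwheel d}
    {φ : V → Site d} (h : R.Embeds W φ) (k : ZMod d) :
    R.Embeds (W.rotate k) (fun v => (φ v).shift (-k)) := by
  rw [← W.rotate_rotate_neg k] at h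
  exact h.of_rotate

/-! ## The bounds imposed by a rule on the degrees in a cartwheel -/

/-- Lower and upper bounds for the degrees in a cartwheel that are admissible for an outlet. -/
structure SiteBounds (d : ℕ) where
  lo : Site d → ℕ
  hi : Site d → ℕ
  lo_le_hi : ∀ s, lo s ≤ hi s
  lo_mem : ∀ s, lo s ∈ ({5, 6, 7, 8, 9} : Set ℕ)
  hi_mem : ∀ s, hi s ∈ ({5, 6, 7, 8, 12} : Set ℕ)
  fan_fixed : ∀ i j, lo (.fan i j) ≠ 5 ∨ hi (.fan i j) ≠ 12 →
    lo (.spoke i) = hi (.spoke i) ∧ 2 ≤ j ∧ j + 4 ≤ lo (.spoke i)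

/-- The bounds hold in the cartwheel `W`, where the upper bound `12` stands for no upper bound. -/
def SiteBounds.HoldIn {d : ℕ} (B : SiteBounds d) (W : Cartwheel d) : Prop :=
  ∀ s, s ≠ .hub → B.lo s ≤ W.γ s ∧ (W.γ s ≤ B.hi s ∨ B.hi s = 12)

section

variable {V : Type} [Fintype V] (R : Rule V) {d : ℕ} (W : Cartwheel d) (φ : V → Site d)

open Classical in
/-- The lower bound of the rule at the vertex embedded as `s`. -/
noncomputable def Rule.lowAt (s : Site d) : ℕ :=
  if h : ∃ v, φ v = s then R.β h.choose else 5

open Classical in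
/-- The upper bound of the rule at the vertex embedded as `s`. -/
noncomputable def Rule.highAt (s : Site d) : ℕ :=
  if h : ∃ v, φ v = s then R.δ h.choose else 12

/-- The rule fixes the degree of `spoke i`. -/
def Rule.FixedAt (i : ZMod d) : Prop := ∃ v, φ v = .spoke i ∧ R.β v = R.δ v

/-- Both hats next to `spoke i` belong to the image of `φ`. -/
def HatsAt (i : ZMod d) : Prop := .hat (i - 1) ∈ Set.range φ ∧ .hat i ∈ Set.range φ

open Classical in
/-- The lower bound imposed on the degrees in cartwheels by a rule that embeds via `φ` into `W`. -/
noncomputable def Rule.low : Site d → ℕ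
  | .spoke i => if R.FixedAt φ i then W.γ (.spoke i) else
      -- If both hats are present, their adjacency in the drawing tells degree five from larger
      -- degrees, so the interval is cut between 5 and 6.
      if HatsAt φ i then (if W.γ (.spoke i) = 5 then 5 else max 6 (R.lowAt φ (.spoke i)))
      else R.lowAt φ (.spoke i)
  | s => R.lowAt φ s

open Classical in
/-- The upper bound imposed on the degrees in cartwheels by a rule that embeds via `φ` into `W`. -/
noncomputable def Rule.high : Site d → ℕ
  | .spoke i => if R.FixedAt φ i then W.γ (.spoke i) else
      if HatsAt φ i ∧ W.γ (.spoke i) = 5 then 5 else R.highAt φ (.spoke i)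
  | s => R.highAt φ s

variable {R W φ}

theorem Rule.lowAt_apply (hφ : Function.Injective φ) (v : V) : R.lowAt φ (φ v) = R.β v := by
  have h : ∃ w, φ w = φ v := ⟨v, rfl⟩
  rw [Rule.lowAt, dif_pos h, hφ h.choose_spec]

theorem Rule.highAt_apply (hφ : Function.Injective φ) (v : V) : R.highAt φ (φ v) = R.δ v := by
  have h : ∃ w, φ w = φ v := ⟨v, rfl⟩
  rw [Rule.highAt, dif_pos h, hφ h.choose_spec]

theorem Rule.lowAt_of_notMem {s : Site d} (hs : s ∉ Set.range φ) : R.lowAt φ s = 5 :=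
  dif_neg hs

theorem Rule.highAt_of_notMem {s : Site d} (hs : s ∉ Set.range φ) : R.highAt φ s = 12 :=
  dif_neg hs

theorem Rule.Limited.lowAt_mem (hl : R.Limited) (s : Site d) :
    R.lowAt φ s ∈ ({5, 6, 7, 8, 9} : Set ℕ) := by
  unfold Rule.lowAt
  split_ifs with h
  · exact (hl _).1
  · simp

theorem Rule.Limited.highAt_mem (hl : R.Limited) (s : Site d) :
    R.highAt φ s ∈ ({5, 6, 7, 8, 12} : Set ℕ) := by
  unfold Rule.highAt
  split_ifs with h
  · exact (hl _).2
  · simp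

theorem Rule.lowAt_le_highAt (s : Site d) : R.lowAt φ s ≤ R.highAt φ s := by
  unfold Rule.lowAt Rule.highAt
  split_ifs with h
  · exact R.β_le_δ _
  · simp

/-- Keeps the interval of an unfixed spoke non-empty when its lower end is raised to 6. -/
theorem Rule.lowAt_lt_highAt {i : ZMod d} (hi : ¬ R.FixedAt φ i) :
    R.lowAt φ (.spoke i) < R.highAt φ (.spoke i) := by
  unfold Rule.lowAt Rule.highAt
  split_ifs with h
  · exact lt_of_le_of_ne (R.β_le_δ _) fun he => hi ⟨_, h.choose_spec, he⟩
  · simp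

/-- The degree of a spoke fixed by a limited rule lies between `5` and `8`. -/
theorem Rule.Embeds.γ_mem_of_fixedAt (h : R.Embeds W φ) (hl : R.Limited) {i : ZMod d}
    (hi : R.FixedAt φ i) : W.γ (.spoke i) ∈ ({5, 6, 7, 8} : Set ℕ) := by
  obtain ⟨v, hv, hβ⟩ := hi
  have h1 := h.le_γ v
  have h2 := h.γ_le v
  have h3 := hl v
  rw [hv] at h1 h2
  simp only [Set.mem_insert_iff, Set.mem_singleton_iff] at h3 ⊢
  omega

theorem Rule.Embeds.fixedAt_of_fan (h : R.Embeds W φ) (hR : R.Coherent)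
    (hub : φ R.s = .hub ∨ φ R.t = .hub) {i : ZMod d} {j : ℕ} (hf : Site.fan i j ∈ Set.range φ) :
    R.FixedAt φ i := by
  obtain ⟨v, hv⟩ := hf
  exact hR.exists_spoke h hub hv

theorem Rule.Embeds.le_of_fan (h : R.Embeds W φ) {i : ZMod d} {j : ℕ}
    (hf : Site.fan i j ∈ Set.range φ) : 2 ≤ j ∧ j + 4 ≤ W.γ (.spoke i) := by
  obtain ⟨v, hv⟩ := hf
  have := h.isVertex v
  rwa [hv] at this

/-- The bounds imposed on the degrees in cartwheels by a rule that embeds via `φ` into `W`. -/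
noncomputable def Rule.Embeds.bounds (h : R.Embeds W φ) (hR : R.Coherent) (hl : R.Limited)
    (hub : φ R.s = .hub ∨ φ R.t = .hub) : SiteBounds d where
  lo := R.low W φ
  hi := R.high W φ
  lo_le_hi s := by
    cases s with
    | spoke i =>
      simp only [Rule.low, Rule.high]
      by_cases hi : R.FixedAt φ i
      · simp [hi]
      · have h1 := Rule.lowAt_lt_highAt hi
        have h2 := hl.lowAt_mem (φ := φ) (.spoke i)
        simp only [Set.mem_insert_iff, Set.mem_singleton_iff] at h2
        rw [if_neg hi, if_neg hi]
        by_cases hh : HatsAt φ i <;> by_cases h5 : W.γ (.spoke i) = 5 <;> simp only [hh, h5, true_and,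
          false_and, if_true, if_false] <;> omega
    | _ => exact Rule.lowAt_le_highAt _
  lo_mem s := by
    cases s with
    | spoke i =>
      unfold Rule.low
      have h2 := hl.lowAt_mem (φ := φ) (.spoke i)
      by_cases hi : R.FixedAt φ i
      · have := h.γ_mem_of_fixedAt hl hi
        simp only [Set.mem_insert_iff, Set.mem_singleton_iff, if_pos hi] at this ⊢
        omega
      · simp only [Set.mem_insert_iff, Set.mem_singleton_iff, if_neg hi] at h2 ⊢
        split_ifs <;> omega
    | _ => exact hl.lowAt_mem _
  hi_mem s := by
    cases s with
    | spoke i =>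
      unfold Rule.high
      have h2 := hl.highAt_mem (φ := φ) (.spoke i)
      by_cases hi : R.FixedAt φ i
      · have := h.γ_mem_of_fixedAt hl hi
        simp only [Set.mem_insert_iff, Set.mem_singleton_iff, if_pos hi] at this ⊢
        omega
      · simp only [Set.mem_insert_iff, Set.mem_singleton_iff, if_neg hi] at h2 ⊢
        split_ifs <;> omega
    | _ => exact hl.highAt_mem _
  fan_fixed i j hij := by
    -- Bounds are trivial off the image; a fan vertex in the image has a fixed spoke by coherence.
    have hf : Site.fan i j ∈ Set.range φ := by
      by_contra hf
      rcases hij with hij | hij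
      · exact hij (Rule.lowAt_of_notMem hf)
      · exact hij (Rule.highAt_of_notMem hf)
    have hi := h.fixedAt_of_fan hR hub hf
    simp only [Rule.low, Rule.high, if_pos hi]
    exact ⟨trivial, h.le_of_fan hf⟩

/-- The bounds hold in each cartwheel into which the rule embeds via `φ`. -/
theorem Rule.Embeds.holdIn (h : R.Embeds W φ) (hR : R.Coherent) (hl : R.Limited)
    (hub : φ R.s = .hub ∨ φ R.t = .hub) {W' : Cartwheel d} (h' : R.Embeds W' φ) :
    (h.bounds hR hl hub).HoldIn W' := by
  have key : ∀ s, R.lowAt φ s ≤ W'.γ s ∧ (W'.γ s ≤ R.highAt φ s ∨ R.highAt φ s = 12) := by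
    intro s
    by_cases hs : s ∈ Set.range φ
    · obtain ⟨v, rfl⟩ := hs
      rw [Rule.lowAt_apply h.inj, Rule.highAt_apply h.inj]
      exact ⟨h'.le_γ v, .inl (h'.γ_le v)⟩
    · rw [Rule.lowAt_of_notMem hs, Rule.highAt_of_notMem hs]
      exact ⟨W'.five_le_γ s, .inr rfl⟩
  intro s _
  cases s with
  | spoke i =>
    change R.low W φ (.spoke i) ≤ _ ∧ (_ ≤ R.high W φ (.spoke i) ∨ R.high W φ (.spoke i) = 12)
    have h1 := key (.spoke i)
    have h5 := W.five_le_γ (.spoke i)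
    have h5' := W'.five_le_γ (.spoke i)
    simp only [Rule.low, Rule.high]
    by_cases hi : R.FixedAt φ i
    · obtain ⟨v, hv, hβ⟩ := id hi
      have a1 := h.le_γ v
      have a2 := h.γ_le v
      have a3 := h'.le_γ v
      have a4 := h'.γ_le v
      rw [hv] at a1 a2 a3 a4
      rw [if_pos hi, if_pos hi]
      omega
    · rw [if_neg hi, if_neg hi]
      by_cases hh : HatsAt φ i
      · have h6 : W.γ (.spoke i) = 5 ↔ W'.γ (.spoke i) = 5 := by
          obtain ⟨⟨v, hv⟩, w, hw⟩ := hh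
          rw [← W.adj_hat_iff, ← W'.adj_hat_iff, ← hv, ← hw, ← h.adj, ← h'.adj]
        by_cases h7 : W.γ (.spoke i) = 5
        · have h8 := h6.1 h7
          simp [hh, h7, h8]
        · have h8 := mt h6.2 h7
          simp only [hh, h7, if_true, if_false, and_false]
          omega
      · simpa [hh] using h1
  | _ => exact key _

/-- The rule embeds via `φ` into each cartwheel in which the bounds hold, if the degrees are at most
`12`. -/
theorem Rule.Embeds.of_holdIn (h : R.Embeds W φ) (hR : R.Coherent) (hl : R.Limited)
    (hub : φ R.s = .hub ∨ φ R.t = .hub) {W' : Cartwheel d} (h' : (h.bounds hR hl hub).HoldIn W')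
    (hspoke : ∀ i, W'.γ (.spoke i) ≤ 12) (hhat : ∀ i, W'.γ (.hat i) ≤ 12)
    (hfan : ∀ i j, (h.bounds hR hl hub).lo (.spoke i) = (h.bounds hR hl hub).hi (.spoke i) →
      2 ≤ j → j + 4 ≤ (h.bounds hR hl hub).lo (.spoke i) → W'.γ (.fan i j) ≤ 12) :
    R.Embeds W' φ := by
  have hfix : ∀ i, R.FixedAt φ i → W.γ (.spoke i) = W'.γ (.spoke i) := by
    intro i hi
    have h1 := h' (.spoke i) (by simp)
    have h2 := h.γ_mem_of_fixedAt hl hi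
    change R.low W φ (.spoke i) ≤ _ ∧ (_ ≤ R.high W φ (.spoke i) ∨ R.high W φ (.spoke i) = 12) at h1
    simp only [Rule.low, Rule.high, if_pos hi, Set.mem_insert_iff, Set.mem_singleton_iff] at h1 h2
    omega
  have hfan' : ∀ i, ¬ R.FixedAt φ i → ∀ j, Site.fan i j ∉ Set.range φ :=
    fun i hi j hf => hi (h.fixedAt_of_fan hR hub hf)
  have hfive : ∀ i, ¬ R.FixedAt φ i → HatsAt φ i → W.γ (.spoke i) = 5 → W'.γ (.spoke i) = 5 := by
    intro i hi hh h5
    have h1 := h' (.spoke i) (by simp)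
    change R.low W φ (.spoke i) ≤ _ ∧ (_ ≤ R.high W φ (.spoke i) ∨ R.high W φ (.spoke i) = 12) at h1
    simp only [Rule.low, Rule.high, if_neg hi, hh, h5, true_and, if_true] at h1
    omega
  have hsix : ∀ i, ¬ R.FixedAt φ i → HatsAt φ i → W.γ (.spoke i) ≠ 5 → 6 ≤ W'.γ (.spoke i) := by
    intro i hi hh h5
    have h1 := (h' (.spoke i) (by simp)).1
    change R.low W φ (.spoke i) ≤ _ at h1
    simp only [Rule.low, if_neg hi, if_pos hh, if_neg h5] at h1
    exact (le_max_left _ _).trans h1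
  have hagree : W.AgreeOn W' (Set.range φ) := by
    intro i
    by_cases hi : R.FixedAt φ i
    · exact .inl (hfix i hi)
    · by_cases h5 : HatsAt φ i ∧ W.γ (.spoke i) = 5
      · exact .inl (h5.2.trans (hfive i hi h5.1 h5.2).symm)
      · refine .inr ⟨hfan' i hi, fun h1 h2 => ?_⟩
        have h6 : W.γ (.spoke i) ≠ 5 := fun h6 => h5 ⟨⟨h1, h2⟩, h6⟩
        have := W.five_le_γ (.spoke i)
        exact ⟨by omega, hsix i hi ⟨h1, h2⟩ h6⟩
  have hβδ : ∀ v, R.β v ≤ W'.γ (φ v) ∧ W'.γ (φ v) ≤ R.δ v := by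
    intro v
    have h1 := h' (φ v)
    have h2 := Rule.lowAt_apply (R := R) h.inj v
    have h3 := Rule.highAt_apply (R := R) h.inj v
    have h4 := h.le_γ v
    have h5 := h.γ_le v
    cases hv : φ v with
    -- The bounds say nothing about the hub, but its degree is `d` in both cartwheels.
    | hub =>
      rw [hv, Cartwheel.γ_hub] at h4 h5
      rw [Cartwheel.γ_hub]
      exact ⟨h4, h5⟩
    | spoke i =>
      rw [hv] at h1 h2 h3 h4 h5
      by_cases hi : R.FixedAt φ i
      · rw [← hfix i hi]
        exact ⟨h4, h5⟩
      · have h1 := h1 (by simp)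
        change R.low W φ (.spoke i) ≤ _ ∧
          (_ ≤ R.high W φ (.spoke i) ∨ R.high W φ (.spoke i) = 12) at h1
        -- Covers the upper bound 12, which `HoldIn` treats as no bound although `δ = 12` is a
        -- genuine one.
        have h7 := hspoke i
        by_cases hh : HatsAt φ i
        · by_cases h6 : W.γ (.spoke i) = 5
          · rw [hfive i hi hh h6]
            rw [h6] at h4 h5
            exact ⟨h4, h5⟩
          · simp only [Rule.low, Rule.high, if_neg hi, if_pos hh, h6, and_false, if_false, h2,
              h3] at h1
            omega
        · simp only [Rule.low, Rule.high, if_neg hi, hh, false_and, if_false, h2, h3] at h1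
          omega
    | hat i =>
      rw [hv] at h1 h2 h3
      have h1 := h1 (by simp)
      change R.lowAt φ (.hat i) ≤ _ ∧ (_ ≤ R.highAt φ (.hat i) ∨ R.highAt φ (.hat i) = 12) at h1
      have := hhat i
      omega
    | fan i j =>
      rw [hv] at h1 h2 h3
      have h1 := h1 (by simp)
      change R.lowAt φ (.fan i j) ≤ _ ∧
        (_ ≤ R.highAt φ (.fan i j) ∨ R.highAt φ (.fan i j) = 12) at h1
      have hf : Site.fan i j ∈ Set.range φ := ⟨v, hv⟩
      have hi := h.fixedAt_of_fan hR hub hf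
      have := hfan i j
      change R.low W φ (.spoke i) = R.high W φ (.spoke i) → _ → _ ≤ R.low W φ (.spoke i) → _ at this
      simp only [Rule.low, Rule.high, if_pos hi, true_imp_iff] at this
      have := this (h.le_of_fan hf).1 (h.le_of_fan hf).2
      omega
  -- For an interior vertex only the first alternative is possible; for a boundary vertex either one
  -- gives the strict inequality in `W'`.
  have hdeg : ∀ v, W.γ (φ v) = W'.γ (φ v) ∨ ((R.graph.neighborSet v).ncard < W.γ (φ v) ∧
      (R.graph.neighborSet v).ncard < W'.γ (φ v)) := by
    intro v
    have g := W.five_le_γ (φ v)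
    have g' := W'.five_le_γ (φ v)
    cases hv : φ v with
    | hub => simp [Cartwheel.γ_hub]
    | spoke i =>
      rw [hv] at g g'
      by_cases hi : R.FixedAt φ i
      · exact .inl (hfix i hi)
      · by_cases hh : HatsAt φ i
        · by_cases h5 : W.γ (.spoke i) = 5
          · exact .inl (h5.trans (hfive i hi hh h5).symm)
          · have := h.ncard_spoke hv (hfan' i hi)
            have := hsix i hi hh h5
            omega
        · have := h.ncard_spoke' hv (hfan' i hi) hh
          omega
    | hat i =>
      rw [hv] at g g'
      have := h.ncard_hat hv
      omega
    | fan i j =>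
      rw [hv] at g g'
      have := h.ncard_fan hv
      omega
  refine ⟨h.inj, fun v => ?_, fun a b => ?_, fun a b c => ?_, fun v => (hβδ v).1,
    fun v => (hβδ v).2, fun v hv => ?_, fun v hv => ?_⟩
  · cases hv : φ v with
    | fan i j =>
      have hf : Site.fan i j ∈ Set.range φ := ⟨v, hv⟩
      have := h.le_of_fan hf
      rwa [hfix i (h.fixedAt_of_fan hR hub hf)] at this
    | _ => trivial
  · rw [h.adj, hagree.adj_iff ⟨a, rfl⟩ ⟨b, rfl⟩]
  · rw [h.tri, hagree.tri_iff ⟨a, rfl⟩ ⟨b, rfl⟩ ⟨c, rfl⟩]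
  · have h1 := h.interior v hv
    have := hdeg v
    omega
  · have h1 := h.boundary v hv
    have := hdeg v
    omega

end

/-! ## The numbers of the vertices -/

/-- The vertices with numbers `1, …, 5d`. -/
def Site.Named {d : ℕ} : Site d → Prop
  | .hub => False
  | .spoke _ => True
  | .hat _ => True
  | .fan _ j => 2 ≤ j ∧ j ≤ 4

theorem Site.Named.ne_hub {d : ℕ} {s : Site d} (h : s.Named) : s ≠ .hub := by
  rintro rfl
  exact h

theorem Site.Named.shift {d : ℕ} {s : Site d} (h : s.Named) (k : ZMod d) : (s.shift k).Named := by
  cases s <;> exact h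

/-- The vertex with the number `p`. -/
def siteNo (d p : ℕ) : Site d :=
  if p = 0 then .hub else if (p - 1) / d = 0 then .spoke ((p - 1 : ℕ) : ZMod d) else
    if (p - 1) / d = 1 then .hat ((p - 1 : ℕ) : ZMod d) else .fan ((p - 1 : ℕ) : ZMod d) ((p - 1) / d)

theorem Site.Named.num_mem {d : ℕ} [NeZero d] {s : Site d} (h : s.Named) :
    1 ≤ s.num ∧ s.num ≤ 5 * d := by
  cases s with
  | hub => exact h.elim
  | spoke i =>
    have := ZMod.val_lt i
    simp only [Site.num]
    omega
  | hat i =>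
    have := ZMod.val_lt i
    simp only [Site.num]
    omega
  | fan i j =>
    have := ZMod.val_lt i
    have := Nat.mul_le_mul_right d h.2
    simp only [Site.num]
    omega

theorem num_siteNo {d : ℕ} [NeZero d] (p : ℕ) : (siteNo d p).num = p := by
  have h1 := Nat.div_add_mod' (p - 1) d
  unfold siteNo
  split_ifs with h2 h3 h4
  · exact h2.symm
  · simp only [Site.num, ZMod.val_natCast]
    rw [h3] at h1
    omega
  · simp only [Site.num, ZMod.val_natCast]
    rw [h4] at h1
    omega
  · simp only [Site.num, ZMod.val_natCast]
    omega

theorem siteNo_mul_add {d j i : ℕ} (hi : 1 ≤ i) (hi' : i ≤ d) :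
    siteNo d (j * d + i) = if j = 0 then .spoke ((i - 1 : ℕ) : ZMod d) else
      if j = 1 then .hat ((i - 1 : ℕ) : ZMod d) else .fan ((i - 1 : ℕ) : ZMod d) j := by
  have h1 : j * d + i - 1 = (i - 1) + d * j := by
    rw [mul_comm]
    omega
  have h2 : (j * d + i - 1) / d = j := by
    rw [h1, Nat.add_mul_div_left _ _ (by omega), Nat.div_eq_of_lt (by omega), zero_add]
  have h3 : ((j * d + i - 1 : ℕ) : ZMod d) = ((i - 1 : ℕ) : ZMod d) := by
    rw [h1]
    push_cast
    simp
  unfold siteNo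
  rw [if_neg (by omega), h2, h3]

theorem Site.Named.siteNo_num {d : ℕ} [NeZero d] {s : Site d} (h : s.Named) :
    siteNo d s.num = s := by
  cases s with
  | hub => exact h.elim
  | spoke i =>
    have := siteNo_mul_add (j := 0) (i := i.val + 1) (by omega) (ZMod.val_lt i)
    simpa [Site.num] using this
  | hat i =>
    have := siteNo_mul_add (j := 1) (i := i.val + 1) (by omega) (ZMod.val_lt i)
    simpa [Site.num] using this
  | fan i j =>
    have := siteNo_mul_add (j := j) (i := i.val + 1) (by omega) (ZMod.val_lt i)
    rw [if_neg (by have := h.1; omega), if_neg (by have := h.1; omega)] at this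
    simpa [Site.num] using this

theorem named_siteNo {d p : ℕ} (h1 : 1 ≤ p) (h2 : p ≤ 5 * d) : (siteNo d p).Named := by
  unfold siteNo
  rw [if_neg (by omega)]
  split_ifs with h3 h4
  · trivial
  · trivial
  · have : (p - 1) / d < 5 := Nat.div_lt_of_lt_mul (by rw [mul_comm]; omega)
    generalize (p - 1) / d = q at *
    exact ⟨by omega, by omega⟩

/-- `(i - 1) % d` is the position inside a block of `d` consecutive numbers, so subtracting `d` on
overflow wraps around within the block: the layer is kept and the spoke index is added modulo `d`.
-/
theorem oplus_num {d : ℕ} [NeZero d] {s : Site d} (hs : s ≠ .hub) {x : ℕ} (hx : x < d) :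
    oplus d s.num x = (s.shift (x : ZMod d)).num := by
  have key : ∀ (i : ZMod d) (j : ℕ),
      oplus d (j * d + (i.val + 1)) x = j * d + ((i + (x : ZMod d)).val + 1) := by
    intro i j
    have hi := ZMod.val_lt i
    have h1 : (j * d + (i.val + 1) - 1) % d = i.val := by
      rw [← add_assoc, Nat.add_sub_cancel, Nat.mul_add_mod', Nat.mod_eq_of_lt hi]
    have h2 : (i + (x : ZMod d)).val = (i.val + x) % d := by
      rw [ZMod.val_add, ZMod.val_natCast, Nat.mod_eq_of_lt hx]
    unfold oplus
    rw [h1, h2]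
    split_ifs with h
    · rw [Nat.mod_eq_of_lt (by omega)]
      omega
    · rw [Nat.mod_eq_sub_mod (by omega), Nat.mod_eq_of_lt (by omega)]
      omega
  cases s with
  | hub => exact absurd rfl hs
  | spoke i => simpa [Site.num, Site.shift] using key i 0
  | hat i => simpa [Site.num, Site.shift] using key i 1
  | fan i j => exact key i j

/-! ## Outlets given by bounds -/

/-- The admissible lower and upper bounds have only 5, 6, 7, 8 in common. -/
theorem SiteBounds.le_eight {d : ℕ} (B : SiteBounds d) {s : Site d} (h : B.lo s = B.hi s) :
    B.hi s ≤ 8 := by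
  have h1 := B.lo_mem s
  have h2 := B.hi_mem s
  simp only [Set.mem_insert_iff, Set.mem_singleton_iff] at h1 h2
  omega

theorem SiteBounds.lo_range {d : ℕ} (B : SiteBounds d) (s : Site d) : 5 ≤ B.lo s ∧ B.lo s ≤ 9 := by
  have h1 := B.lo_mem s
  simp only [Set.mem_insert_iff, Set.mem_singleton_iff] at h1
  omega

theorem SiteBounds.hi_range {d : ℕ} (B : SiteBounds d) (s : Site d) :
    5 ≤ B.hi s ∧ B.hi s ≤ 12 := by
  have h1 := B.hi_mem s
  simp only [Set.mem_insert_iff, Set.mem_singleton_iff] at h1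
  omega

theorem SiteBounds.trivial_or {d : ℕ} (B : SiteBounds d) (i : ZMod d) (j : ℕ) :
    (B.lo (.fan i j) = 5 ∧ B.hi (.fan i j) = 12) ∨
      (B.lo (.spoke i) = B.hi (.spoke i) ∧ 2 ≤ j ∧ j + 4 ≤ B.lo (.spoke i)) := by
  have := B.fan_fixed i j
  tauto

/-- A fan vertex with non-trivial bounds satisfies `j + 4 ≤ 8`. Hence the numbers up to `5d` carry
all the constraints. -/
theorem SiteBounds.trivial_of_not_named {d : ℕ} (B : SiteBounds d) {s : Site d} (hs : s ≠ .hub)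
    (hn : ¬ s.Named) : B.lo s = 5 ∧ B.hi s = 12 := by
  cases s with
  | hub => exact absurd rfl hs
  | spoke i => exact absurd trivial hn
  | hat i => exact absurd trivial hn
  | fan i j =>
    rcases B.trivial_or i j with h | ⟨h1, h2, h3⟩
    · exact h
    · have := B.le_eight h1
      exact absurd ⟨h2, by omega⟩ hn

open Classical in
/-- The triples of an outlet given by bounds. -/
noncomputable def SiteBounds.triples {d : ℕ} (B : SiteBounds d) : Finset (ℕ × ℕ × ℕ) :=
  ((Finset.Icc 1 (5 * d)).filter fun p => B.lo (siteNo d p) ≠ 5 ∨ B.hi (siteNo d p) ≠ 12).image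
    fun p => (p, B.lo (siteNo d p), B.hi (siteNo d p))

theorem SiteBounds.mem_triples {d : ℕ} (B : SiteBounds d) (p l u : ℕ) :
    (p, l, u) ∈ B.triples ↔ (1 ≤ p ∧ p ≤ 5 * d) ∧ l = B.lo (siteNo d p) ∧ u = B.hi (siteNo d p) ∧
      (l ≠ 5 ∨ u ≠ 12) := by
  simp only [SiteBounds.triples, Finset.mem_image, Finset.mem_filter, Finset.mem_Icc, Prod.mk.injEq]
  constructor
  · rintro ⟨q, ⟨h1, h2⟩, rfl, rfl, rfl⟩
    exact ⟨h1, rfl, rfl, h2⟩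
  · rintro ⟨h1, rfl, rfl, h2⟩
    exact ⟨p, ⟨h1, h2⟩, rfl, rfl, rfl⟩

/-- The outlet given by bounds. -/
noncomputable def SiteBounds.outlet {d : ℕ} (B : SiteBounds d) (z : ℤ) (hz : z ≠ 0) : Outlet d where
  M := B.triples
  value := z
  value_ne_zero := hz
  p_mem p l u h := ((B.mem_triples p l u).1 h).1
  l_le_u p l u h := by
    obtain ⟨-, rfl, rfl, -⟩ := (B.mem_triples p l u).1 h
    exact B.lo_le_hi _
  bounds_mem p l u h := by
    obtain ⟨-, rfl, rfl, -⟩ := (B.mem_triples p l u).1 h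
    exact ⟨B.lo_mem _, B.hi_mem _⟩
  fan_fixed p l u h j hj i hi hi' hp := by
    obtain ⟨h1, rfl, rfl, h2⟩ := (B.mem_triples p l u).1 h
    subst hp
    simp only [Set.mem_insert_iff, Set.mem_singleton_iff] at hj
    rw [siteNo_mul_add hi hi', if_neg (by omega), if_neg (by omega)] at h2
    obtain ⟨h3, -, h4⟩ := B.fan_fixed _ _ h2
    have h5 := siteNo_mul_add (j := 0) hi hi'
    rw [zero_mul, zero_add, if_pos rfl] at h5
    -- The spoke has equal bounds, so its triple is not `(i, 5, 12)` and has not been discarded.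
    refine ⟨B.lo (siteNo d i), (B.mem_triples _ _ _).2 ⟨⟨hi, by omega⟩, rfl, by rw [h5, h3], ?_⟩, ?_⟩
    · omega
    · rwa [h5]

theorem SiteBounds.outlet_reduced {d : ℕ} (B : SiteBounds d) (z : ℤ) (hz : z ≠ 0) :
    (B.outlet z hz).Reduced := by
  constructor
  · intro p l u l' u' h h'
    obtain ⟨-, rfl, rfl, -⟩ := (B.mem_triples _ _ _).1 h
    obtain ⟨-, rfl, rfl, -⟩ := (B.mem_triples _ _ _).1 h'
    exact ⟨rfl, rfl⟩
  · intro p h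
    have := ((B.mem_triples _ _ _).1 h).2.2.2
    omega

/-! ## Axles -/

theorem Axle.range {d : ℕ} (A : Axle d) {p : ℕ} (h1 : 1 ≤ p) (h2 : p ≤ 5 * d) :
    5 ≤ A.l p ∧ A.l p ≤ 9 ∧ A.l p ≤ A.u p ∧ 5 ≤ A.u p ∧ A.u p ≤ 12 ∧ (A.l p = A.u p → A.u p ≤ 8) := by
  have h3 := A.l_mem p h1 h2
  have h4 := A.u_mem p h1 h2
  have h5 := A.l_le_u p h1 h2
  simp only [Set.mem_insert_iff, Set.mem_singleton_iff] at h3 h4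
  omega

/-- The cartwheel with given degrees at the numbered vertices. -/
def Cartwheel.ofNum {d : ℕ} (hd : 5 ≤ d) (f : ℕ → ℕ) : Cartwheel d where
  five_le_d := hd
  γ | .hub => d
    -- Fan vertices with numbers above `5d` may receive arbitrary values from `f`; the maximum keeps
    -- them legal.
    | s => max 5 (f s.num)
  γ_hub := rfl
  five_le_γ s := by
    cases s with
    | hub => exact hd
    | _ => exact le_max_left _ _

theorem Cartwheel.γ_ofNum {d : ℕ} (hd : 5 ≤ d) (f : ℕ → ℕ) {s : Site d} (hs : s.Named) :
    (Cartwheel.ofNum hd f).γ s = max 5 (f s.num) := by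
  cases s with
  | hub => exact hs.elim
  | _ => rfl

theorem SiteBounds.holdIn_iff_named {d : ℕ} (B : SiteBounds d) (W : Cartwheel d) :
    B.HoldIn W ↔ ∀ s : Site d, s.Named → B.lo s ≤ W.γ s ∧ (W.γ s ≤ B.hi s ∨ B.hi s = 12) := by
  refine ⟨fun h s hs => h s hs.ne_hub, fun h s hs => ?_⟩
  by_cases hn : s.Named
  · exact h s hn
  · obtain ⟨h1, h2⟩ := B.trivial_of_not_named hs hn
    rw [h1, h2]
    exact ⟨W.five_le_γ s, .inr rfl⟩

/-- The degrees of the spokes, the hats and those fan vertices for which the bounds may be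
non-trivial are at most `12`. -/
def SiteBounds.Capped {d : ℕ} (B : SiteBounds d) (W : Cartwheel d) : Prop :=
  (∀ i, W.γ (.spoke i) ≤ 12) ∧ (∀ i, W.γ (.hat i) ≤ 12) ∧
    ∀ i j, B.lo (.spoke i) = B.hi (.spoke i) → 2 ≤ j → j + 4 ≤ B.lo (.spoke i) →
      W.γ (.fan i j) ≤ 12

theorem SiteBounds.capped_of_named {d : ℕ} {B : SiteBounds d} {W : Cartwheel d}
    (h : ∀ s : Site d, s.Named → W.γ s ≤ 12) : B.Capped W := by
  refine ⟨fun i => h _ trivial, fun i => h _ trivial, fun i j h1 h2 h3 => h _ ⟨h2, ?_⟩⟩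
  have := B.le_eight h1
  omega

/-! ### Enforcement and permission as comparisons of intervals. -/

section

variable {d : ℕ} [NeZero d]

theorem Axle.site_range (A : Axle d) {s : Site d} (hs : s.Named) :
    5 ≤ A.l s.num ∧ A.l s.num ≤ 9 ∧ A.l s.num ≤ A.u s.num ∧ 5 ≤ A.u s.num ∧ A.u s.num ≤ 12 ∧
      (A.l s.num = A.u s.num → A.u s.num ≤ 8) :=
  A.range hs.num_mem.1 hs.num_mem.2

theorem SiteBounds.mem_outlet (B : SiteBounds d) (z : ℤ) (hz : z ≠ 0) {s : Site d} (hs : s.Named) :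
    (B.lo s = 5 ∧ B.hi s = 12) ∨ (s.num, B.lo s, B.hi s) ∈ (B.outlet z hz).M := by
  by_cases h : B.lo s = 5 ∧ B.hi s = 12
  · exact .inl h
  · refine .inr ((B.mem_triples _ _ _).2 ⟨hs.num_mem, ?_, ?_, by tauto⟩) <;> rw [hs.siteNo_num]

/-- The outlet omits the trivial triples; this is harmless for any condition that the bounds `(5,
12)` always meet, as `hP` requires. -/
theorem SiteBounds.forall_outlet (B : SiteBounds d) (z : ℤ) (hz : z ≠ 0) (x : ℕ) (hx : x < d)
    (P : ℕ → ℕ → ℕ → Prop) (hP : ∀ s : Site d, s.Named → P s.num 5 12) :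
    (∀ p l u, (p, l, u) ∈ (B.outlet z hz).M → P (oplus d p x) l u) ↔
      ∀ s : Site d, s.Named → P (s.shift (x : ZMod d)).num (B.lo s) (B.hi s) := by
  constructor
  · intro h s hs
    rcases B.mem_outlet z hz hs with h1 | h1
    · rw [h1.1, h1.2]
      exact hP _ (hs.shift _)
    · have := h _ _ _ h1
      rwa [oplus_num hs.ne_hub hx] at this
  · intro h p l u hp
    obtain ⟨h1, rfl, rfl, -⟩ := (B.mem_triples _ _ _).1 hp
    have hs := named_siteNo h1.1 h1.2
    have := h _ hs
    rwa [← oplus_num hs.ne_hub hx, num_siteNo] at this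

theorem SiteBounds.enforcedAt_iff (B : SiteBounds d) (z : ℤ) (hz : z ≠ 0) {x : ℕ} (h1 : 1 ≤ x)
    (h2 : x ≤ d) (A : Axle d) :
    (B.outlet z hz).EnforcedAt x A ↔ ∀ s : Site d, s.Named →
      B.lo s ≤ A.l (s.shift ((x - 1 : ℕ) : ZMod d)).num ∧
        A.u (s.shift ((x - 1 : ℕ) : ZMod d)).num ≤ B.hi s := by
  refine (B.forall_outlet z hz (x - 1) (by omega) (fun q l u => l ≤ A.l q ∧ A.l q ≤ A.u q ∧ A.u q ≤ u)
    fun s hs => ?_).trans ?_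
  · have := A.site_range hs
    omega
  · refine forall₂_congr fun s hs => ?_
    have := A.site_range (hs.shift ((x - 1 : ℕ) : ZMod d))
    omega

theorem SiteBounds.permittedAt_iff (B : SiteBounds d) (z : ℤ) (hz : z ≠ 0) {x : ℕ} (h1 : 1 ≤ x)
    (h2 : x ≤ d) (A : Axle d) :
    (B.outlet z hz).PermittedAt x A ↔ ∀ s : Site d, s.Named →
      A.l (s.shift ((x - 1 : ℕ) : ZMod d)).num ≤ B.hi s ∧
        B.lo s ≤ A.u (s.shift ((x - 1 : ℕ) : ZMod d)).num := by
  refine B.forall_outlet z hz (x - 1) (by omega) (fun q l u => A.l q ≤ u ∧ l ≤ A.u q)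
    fun s hs => ?_
  have := A.site_range hs
  omega

theorem Cartwheel.compatible_of_named {W : Cartwheel d} {A : Axle d}
    (h : ∀ s : Site d, s.Named → A.l s.num ≤ W.γ s ∧ W.γ s ≤ A.u s.num) : W.Compatible A := by
  refine ⟨fun i => h _ trivial, fun i => h _ trivial, fun i hi j h2 h4 => h _ ⟨h2, ?_⟩⟩
  have := A.site_range (s := .spoke i) trivial
  omega

/-- An axle enforces the bounds if and only if they hold in each compatible cartwheel. -/
theorem SiteBounds.enforced_iff (hd : 5 ≤ d) (B : SiteBounds d) (A : Axle d) (k : ZMod d)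
    (Q : Cartwheel d → Prop) (hQ : ∀ W, Q W → B.HoldIn (W.rotate k))
    (hQ' : ∀ W, B.HoldIn (W.rotate k) → B.Capped (W.rotate k) → Q W) :
    (∀ s : Site d, s.Named → B.lo s ≤ A.l (s.shift k).num ∧ A.u (s.shift k).num ≤ B.hi s) ↔
      ∀ W : Cartwheel d, W.Compatible A → Q W := by
  constructor
  · rintro h W ⟨hs, hh, hf⟩
    -- Where `B` fixes a spoke, the interval of `A` inside it is the same single point, so
    -- compatibility does constrain the fan vertices over that spoke.
    have fan : ∀ i j, B.lo (.spoke i) = B.hi (.spoke i) → 2 ≤ j → j + 4 ≤ B.lo (.spoke i) →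
        B.lo (.fan i j) ≤ W.γ (.fan (i + k) j) ∧ W.γ (.fan (i + k) j) ≤ B.hi (.fan i j) ∧
          W.γ (.fan (i + k) j) ≤ 12 := by
      intro i j h1 h2 h3
      have h4 := h (.spoke i) trivial
      have h5 := A.site_range (s := .spoke (i + k)) trivial
      have h8 := B.le_eight h1
      have hn : Site.Named (.fan i j) := ⟨h2, by omega⟩
      simp only [Site.shift] at h4
      have h6 := hf (i + k) (by omega) j h2 (by omega)
      have h7 := h _ hn
      have h9 := A.site_range (hn.shift k)
      simp only [Site.shift] at h7 h9
      omega
    have spoke : ∀ i, B.lo (.spoke i) ≤ W.γ (.spoke (i + k)) ∧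
        W.γ (.spoke (i + k)) ≤ B.hi (.spoke i) ∧ W.γ (.spoke (i + k)) ≤ 12 := by
      intro i
      have h1 := h (.spoke i) trivial
      have h2 := A.site_range (s := .spoke (i + k)) trivial
      have h3 := hs (i + k)
      simp only [Site.shift] at h1
      omega
    have hat : ∀ i, B.lo (.hat i) ≤ W.γ (.hat (i + k)) ∧
        W.γ (.hat (i + k)) ≤ B.hi (.hat i) ∧ W.γ (.hat (i + k)) ≤ 12 := by
      intro i
      have h1 := h (.hat i) trivial
      have h2 := A.site_range (s := .hat (i + k)) trivial
      have h3 := hh (i + k)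
      simp only [Site.shift] at h1
      omega
    refine hQ' W ((B.holdIn_iff_named _).2 fun s hn => ?_) ⟨fun i => (spoke i).2.2,
      fun i => (hat i).2.2, fun i j h1 h2 h3 => (fan i j h1 h2 h3).2.2⟩
    cases s with
    | hub => exact hn.elim
    | spoke i => exact ⟨(spoke i).1, .inl (spoke i).2.1⟩
    | hat i => exact ⟨(hat i).1, .inl (hat i).2.1⟩
    | fan i j =>
      rcases B.trivial_or i j with ⟨h1, h2⟩ | ⟨h1, h2, h3⟩
      · rw [h1]
        exact ⟨Cartwheel.five_le_γ _ _, .inr h2⟩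
      · exact ⟨(fan i j h1 h2 h3).1, .inl (fan i j h1 h2 h3).2.1⟩
  · intro h s hs
    have hs' := hs.shift k
    have h0 := A.site_range hs'
    -- The two extreme compatible cartwheels, with all degrees at the lower and at the upper bounds
    -- of `A`, test the two inequalities.
    have h1 := hQ _ (h (Cartwheel.ofNum hd A.l) (Cartwheel.compatible_of_named fun s hs => by
      have := A.site_range hs
      rw [Cartwheel.γ_ofNum hd _ hs]
      omega)) s hs.ne_hub
    have h2 := hQ _ (h (Cartwheel.ofNum hd A.u) (Cartwheel.compatible_of_named fun s hs => by
      have := A.site_range hs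
      rw [Cartwheel.γ_ofNum hd _ hs]
      omega)) s hs.ne_hub
    change _ ≤ (Cartwheel.ofNum hd A.l).γ (s.shift k) ∧ _ at h1
    change _ ∧ ((Cartwheel.ofNum hd A.u).γ (s.shift k) ≤ _ ∨ _) at h2
    rw [Cartwheel.γ_ofNum hd _ hs'] at h1 h2
    omega

/-- An axle permits the bounds if and only if they hold in some compatible cartwheel. -/
theorem SiteBounds.permitted_iff (hd : 5 ≤ d) (B : SiteBounds d) (A : Axle d) (k : ZMod d)
    (Q : Cartwheel d → Prop) (hQ : ∀ W, Q W → B.HoldIn (W.rotate k))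
    (hQ' : ∀ W, B.HoldIn (W.rotate k) → B.Capped (W.rotate k) → Q W) :
    (∀ s : Site d, s.Named → A.l (s.shift k).num ≤ B.hi s ∧ B.lo s ≤ A.u (s.shift k).num) ↔
      ∃ W : Cartwheel d, W.Compatible A ∧ Q W := by
  constructor
  · intro h
    -- The smallest degrees that meet both lower bounds; as the intervals meet, these respect both
    -- upper bounds.
    let W := Cartwheel.ofNum hd fun p => max (A.l p) (B.lo ((siteNo d p).shift (-k)))
    have hW : ∀ s : Site d, s.Named → W.γ (s.shift k) = max (A.l (s.shift k).num) (B.lo s) := by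
      intro s hs
      have h1 := A.site_range (hs.shift k)
      rw [Cartwheel.γ_ofNum hd _ (hs.shift k), (hs.shift k).siteNo_num, Site.shift_shift,
        add_neg_cancel, Site.shift_zero]
      omega
    refine ⟨W, Cartwheel.compatible_of_named fun s hs => ?_, hQ' W ?_ ?_⟩
    · have h1 := hW _ (hs.shift (-k))
      have h2 := h _ (hs.shift (-k))
      have h3 := A.site_range hs
      rw [Site.shift_shift, neg_add_cancel, Site.shift_zero] at h1 h2
      omega
    · refine (B.holdIn_iff_named _).2 fun s hs => ?_
      have h1 := h s hs
      have h2 := B.lo_le_hi s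
      change _ ≤ W.γ (s.shift k) ∧ (W.γ (s.shift k) ≤ _ ∨ _)
      rw [hW s hs]
      omega
    · refine SiteBounds.capped_of_named fun s hs => ?_
      have h1 := A.site_range (hs.shift k)
      have h2 := B.lo_range s
      change W.γ (s.shift k) ≤ 12
      rw [hW s hs]
      omega
  · rintro ⟨W, ⟨hs, hh, hf⟩, hW⟩ s hn
    have hB := hQ W hW
    have h1 := hB s hn.ne_hub
    have h2 := A.site_range (hn.shift k)
    have h3 := B.lo_range s
    have h4 := B.hi_range s
    cases s with
    | hub => exact hn.elim
    | spoke i =>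
      have h5 := hs (i + k)
      change _ ≤ W.γ (.spoke (i + k)) ∧ (W.γ (.spoke (i + k)) ≤ _ ∨ _) at h1
      simp only [Site.shift] at h2 ⊢
      omega
    | hat i =>
      have h5 := hh (i + k)
      change _ ≤ W.γ (.hat (i + k)) ∧ (W.γ (.hat (i + k)) ≤ _ ∨ _) at h1
      simp only [Site.shift] at h2 ⊢
      omega
    | fan i j =>
      have h5 := hf (i + k)
      have h6 := hs (i + k)
      have h7 := hB (.spoke i) (by simp)
      change _ ≤ W.γ (.fan (i + k) j) ∧ (W.γ (.fan (i + k) j) ≤ _ ∨ _) at h1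
      change _ ≤ W.γ (.spoke (i + k)) ∧ (W.γ (.spoke (i + k)) ≤ _ ∨ _) at h7
      simp only [Site.shift] at h2 ⊢
      by_cases hA : A.l (Site.spoke (i + k)).num = A.u (Site.spoke (i + k)).num
      · rcases B.trivial_or i j with h8 | ⟨h8, h9, h10⟩
        -- Trivial bounds of `B` meet every interval of an axle.
        · omega
        -- `A` and `B` both fix this spoke at its degree in `W`, so the degree of the fan vertex in
        -- `W` lies in both intervals.
        · have h11 := B.le_eight h8
          have h12 := h5 hA j h9 (by omega)
          omega
      -- Compatibility says nothing about fan vertices over a spoke that `A` does not fix, but there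
      -- `A` has the bounds `(5, 12)`.
      · have h8 := Site.Named.num_mem (s := Site.spoke (i + k)) trivial
        have h9 := A.fan_trivial _ h8.1 (ZMod.val_lt (i + k)) hA j (by
          have := hn.1
          have := hn.2
          simp only [Set.mem_insert_iff, Set.mem_singleton_iff]
          omega)
        change A.l (Site.fan (i + k) j).num = 5 ∧ A.u (Site.fan (i + k) j).num = 12 at h9
        omega

end

/-! ## Reduced outlets are determined by the axles that enforce them -/

open Classical in
/-- The axle given by the bounds of an outlet. -/
noncomputable def Outlet.axle {d : ℕ} (T : Outlet d) (hT : T.Reduced) : Axle d where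
  l p := if h : ∃ q : ℕ × ℕ, (p, q) ∈ T.M then h.choose.1 else 5
  u p := if h : ∃ q : ℕ × ℕ, (p, q) ∈ T.M then h.choose.2 else 12
  l_le_u p _ _ := by
    split_ifs with h
    · exact T.l_le_u _ _ _ h.choose_spec
    · simp
  l_mem p _ _ := by
    split_ifs with h
    · exact (T.bounds_mem _ _ _ h.choose_spec).1
    · simp
  u_mem p _ _ := by
    split_ifs with h
    · exact (T.bounds_mem _ _ _ h.choose_spec).2
    · simp
  fan_trivial i hi hi' hne j hj := by
    -- A triple at a fan vertex comes with a triple `(i, k, k)`, which would make the bounds at `i`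
    -- equal.
    have h : ¬ ∃ q : ℕ × ℕ, (j * d + i, q) ∈ T.M := by
      rintro ⟨q, hq⟩
      obtain ⟨k, hk, -⟩ := T.fan_fixed _ _ _ hq j hj i hi hi' rfl
      have h : ∃ q : ℕ × ℕ, (i, q) ∈ T.M := ⟨_, hk⟩
      rw [dif_pos h, dif_pos h] at hne
      obtain ⟨h1, h2⟩ := hT.1 _ _ _ _ _ hk h.choose_spec
      exact hne (h1.symm.trans h2)
    rw [dif_neg h, dif_neg h]
    exact ⟨rfl, rfl⟩

theorem Outlet.axle_apply {d : ℕ} {T : Outlet d} (hT : T.Reduced) {p l u : ℕ}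
    (h : (p, l, u) ∈ T.M) : (T.axle hT).l p = l ∧ (T.axle hT).u p = u := by
  have h' : ∃ q : ℕ × ℕ, (p, q) ∈ T.M := ⟨_, h⟩
  obtain ⟨h1, h2⟩ := hT.1 _ _ _ _ _ h h'.choose_spec
  constructor
  · exact (dif_pos h').trans h1.symm
  · exact (dif_pos h').trans h2.symm

theorem Outlet.enforcedAt_one {d : ℕ} [NeZero d] (T : Outlet d) (A : Axle d) :
    T.EnforcedAt 1 A ↔ ∀ p l u, (p, l, u) ∈ T.M → l ≤ A.l p ∧ A.l p ≤ A.u p ∧ A.u p ≤ u := by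
  have (p : ℕ) : oplus d p (1 - 1) = p := if_pos (by simpa using Nat.mod_lt _ (NeZero.pos d))
  simp only [Outlet.EnforcedAt, this]

/-- Test the implication on the axle of `T` itself, which enforces `T`. Where `T` has no triple this
axle has bounds `(5, 12)`, which could only enforce the forbidden triple `(p, 5, 12)`. -/
theorem Outlet.exists_triple {d : ℕ} [NeZero d] {T T' : Outlet d} (hT : T.Reduced)
    (hT' : T'.Reduced) (h : ∀ A, T.EnforcedAt 1 A → T'.EnforcedAt 1 A) {p l' u' : ℕ}
    (hp : (p, l', u') ∈ T'.M) : ∃ l u, (p, l, u) ∈ T.M ∧ l' ≤ l ∧ u ≤ u' := by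
  have h1 : T.EnforcedAt 1 (T.axle hT) := by
    refine (T.enforcedAt_one _).2 fun q l u hq => ?_
    obtain ⟨rfl, rfl⟩ := T.axle_apply hT hq
    exact ⟨le_rfl, T.l_le_u _ _ _ hq, le_rfl⟩
  have h2 := (T'.enforcedAt_one _).1 (h _ h1) _ _ _ hp
  by_cases hq : ∃ q : ℕ × ℕ, (p, q) ∈ T.M
  · obtain ⟨⟨l, u⟩, hq⟩ := hq
    obtain ⟨rfl, rfl⟩ := T.axle_apply hT hq
    exact ⟨_, _, hq, h2.1, h2.2.2⟩
  · exfalso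
    have h3 : (T.axle hT).l p = 5 := dif_neg hq
    have h4 : (T.axle hT).u p = 12 := dif_neg hq
    have h5 := T'.bounds_mem _ _ _ hp
    simp only [Set.mem_insert_iff, Set.mem_singleton_iff] at h5
    obtain rfl : l' = 5 := by omega
    obtain rfl : u' = 12 := by omega
    exact hT'.2 _ hp

/-- Refining a triple of `T` by one of `T'` and that by one of `T` leads back to the same triple, as
first entries are distinct; so all three coincide. -/
theorem Outlet.M_subset {d : ℕ} [NeZero d] {T T' : Outlet d} (hT : T.Reduced) (hT' : T'.Reduced)
    (h : ∀ A, T.EnforcedAt 1 A ↔ T'.EnforcedAt 1 A) : T.M ⊆ T'.M := by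
  rintro ⟨p, l, u⟩ hp
  obtain ⟨l', u', h1, h2, h3⟩ := Outlet.exists_triple hT' hT (fun A => (h A).2) hp
  obtain ⟨l'', u'', h4, h5, h6⟩ := Outlet.exists_triple hT hT' (fun A => (h A).1) h1
  obtain ⟨rfl, rfl⟩ := hT.1 _ _ _ _ _ hp h4
  obtain rfl : l = l' := by omega
  obtain rfl : u = u' := by omega
  exact h1

theorem Outlet.eq_of_enforcedAt_iff {d : ℕ} [NeZero d] {T T' : Outlet d} (hT : T.Reduced)
    (hT' : T'.Reduced) (hv : T.value = T'.value) (h : ∀ A, T.EnforcedAt 1 A ↔ T'.EnforcedAt 1 A) :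
    T = T' := by
  have := (Outlet.M_subset hT hT' h).antisymm (Outlet.M_subset hT' hT fun A => (h A).symm)
  cases T
  cases T'
  simp_all

/-- The axle without restrictions. -/
def Axle.unrestricted (d : ℕ) : Axle d where
  l _ := 5
  u _ := 12
  l_le_u _ _ _ := by simp
  l_mem _ _ _ := by simp
  u_mem _ _ _ := by simp
  fan_trivial _ _ _ _ _ _ := ⟨rfl, rfl⟩

theorem Outlet.permittedAt_unrestricted {d : ℕ} (T : Outlet d) (x : ℕ) :
    T.PermittedAt x (Axle.unrestricted d) := by
  intro p l u hp
  have h := T.bounds_mem _ _ _ hp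
  simp only [Set.mem_insert_iff, Set.mem_singleton_iff] at h
  change 5 ≤ u ∧ l ≤ 12
  omega

/-! ## The main theorem -/

/-- A coherent rule has a pass with `a` at the hub and `b` at a spoke, where `a` and `b` are the
source and the sink in some order, if and only if it is represented by a unique reduced outlet. -/
theorem Rule.exists_embeds_iff_existsUnique_outlet {d : ℕ} (hd : 5 ≤ d) {V : Type} [Fintype V]
    (R : Rule V) (hR : R.Coherent) (hl : R.Limited) (a b : V)
    (hab : (a = R.s ∧ b = R.t) ∨ (a = R.t ∧ b = R.s)) (z : ℤ) (hz : z ≠ 0)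
    (Q : Cartwheel d → ZMod d → Prop)
    (hQ : ∀ W i, Q W i ↔ ∃ φ, R.Embeds W φ ∧ φ a = .hub ∧ φ b = .spoke i) :
    (∃ (W : Cartwheel d) (i : ZMod d), Q W i) ↔
      ∃! T : Outlet d, T.Reduced ∧ T.value = z ∧
        ∀ (A : Axle d) (x : ℕ), 1 ≤ x → x ≤ d →
          (T.EnforcedAt x A ↔ ∀ W : Cartwheel d, W.Compatible A → Q W ((x - 1 : ℕ) : ZMod d)) ∧
          (T.PermittedAt x A ↔
            ∃ W : Cartwheel d, W.Compatible A ∧ Q W ((x - 1 : ℕ) : ZMod d)) := by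
  have : NeZero d := ⟨by omega⟩
  constructor
  · rintro ⟨W₁, i, h₁⟩
    -- Rotating the given pass to `spoke 0` provides the reference embedding from which the outlet
    -- is read off.
    obtain ⟨W₀, φ, h, ha, hb⟩ :
        ∃ (W₀ : Cartwheel d) (φ : V → Site d), R.Embeds W₀ φ ∧ φ a = .hub ∧ φ b = .spoke 0 := by
      obtain ⟨φ, h, ha, hb⟩ := (hQ _ _).1 h₁
      exact ⟨_, _, h.rotate i, by simp [ha, Site.shift], by simp [hb, Site.shift]⟩
    have hub : φ R.s = .hub ∨ φ R.t = .hub := by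
      rcases hab with ⟨rfl, rfl⟩ | ⟨rfl, rfl⟩
      · exact .inl ha
      · exact .inr ha
    let B := h.bounds hR hl hub
    have hB : ∀ k W, Q W k → B.HoldIn (W.rotate k) := by
      intro k W hW
      obtain ⟨φ', h', ha', hb'⟩ := (hQ _ _).1 hW
      have h'' := h'.rotate k
      have ha'' : (φ' a).shift (-k) = φ a := by rw [ha', ha]; rfl
      have hb'' : (φ' b).shift (-k) = φ b := by simp [hb', hb, Site.shift]
      -- By rigidity every pass at spoke `k`, rotated back, is the reference embedding.
      have heq : φ = fun v => (φ' v).shift (-k) := by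
        rcases hab with ⟨rfl, rfl⟩ | ⟨rfl, rfl⟩
        · exact h.unique hR h'' hub ha''.symm hb''.symm
        · exact h.unique hR h'' hub hb''.symm ha''.symm
      rw [← heq] at h''
      exact h.holdIn hR hl hub h''
    have hB' : ∀ k W, B.HoldIn (W.rotate k) → B.Capped (W.rotate k) → Q W k := by
      intro k W hW hcap
      refine (hQ _ _).2 ⟨_, (h.of_holdIn hR hl hub hW hcap.1 hcap.2.1 hcap.2.2).of_rotate, ?_, ?_⟩
      · rw [ha]; rfl
      · simp [hb, Site.shift]
    have hT : ∀ (A : Axle d) (x : ℕ), 1 ≤ x → x ≤ d →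
        ((B.outlet z hz).EnforcedAt x A ↔
          ∀ W : Cartwheel d, W.Compatible A → Q W ((x - 1 : ℕ) : ZMod d)) ∧
        ((B.outlet z hz).PermittedAt x A ↔
          ∃ W : Cartwheel d, W.Compatible A ∧ Q W ((x - 1 : ℕ) : ZMod d)) := by
      intro A x h1 h2
      rw [B.enforcedAt_iff z hz h1 h2, B.permittedAt_iff z hz h1 h2]
      exact ⟨B.enforced_iff hd A _ (fun W => Q W _) (hB _) (hB' _),
        B.permitted_iff hd A _ (fun W => Q W _) (hB _) (hB' _)⟩
    refine ⟨B.outlet z hz, ⟨B.outlet_reduced z hz, rfl, hT⟩, fun T ⟨hred, hval, hT'⟩ => ?_⟩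
    exact Outlet.eq_of_enforcedAt_iff hred (B.outlet_reduced z hz) hval fun A =>
      ((hT' A 1 le_rfl (by omega)).1).trans ((hT A 1 le_rfl (by omega)).1).symm
  · rintro ⟨T, ⟨-, -, hT⟩, -⟩
    obtain ⟨W, -, hW⟩ := (hT (Axle.unrestricted d) 1 le_rfl (by omega)).2.1
      (T.permittedAt_unrestricted 1)
    exact ⟨W, _, hW⟩

theorem mainTheorem9 (d : ℕ) (hd : d ∈ ({7, 8, 9, 10, 11} : Set ℕ)) {V : Type} [Fintype V]
    (R : Rule V) (hcoherent : R.Coherent) (hlimited : R.Limited) :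
    ((∃ (W : Cartwheel d) (i : ZMod d), R.HasPass W (.spoke i) .hub) ↔
      ∃! T : Outlet d, T.Reduced ∧ T.value = (R.r : ℤ) ∧
        ∀ (A : Axle d) (x : ℕ), 1 ≤ x → x ≤ d →
          (T.EnforcedAt x A ↔
            ∀ W : Cartwheel d, W.Compatible A → R.HasPass W (spokeNo d x) .hub) ∧
          (T.PermittedAt x A ↔
            ∃ W : Cartwheel d, W.Compatible A ∧ R.HasPass W (spokeNo d x) .hub)) ∧
    ((∃ (W : Cartwheel d) (i : ZMod d), R.HasPass W .hub (.spoke i)) ↔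
      ∃! T' : Outlet d, T'.Reduced ∧ T'.value = -(R.r : ℤ) ∧
        ∀ (A : Axle d) (x : ℕ), 1 ≤ x → x ≤ d →
          (T'.EnforcedAt x A ↔
            ∀ W : Cartwheel d, W.Compatible A → R.HasPass W .hub (spokeNo d x)) ∧
          (T'.PermittedAt x A ↔
            ∃ W : Cartwheel d, W.Compatible A ∧ R.HasPass W .hub (spokeNo d x))) := by
  have hd5 : 5 ≤ d := by
    simp only [Set.mem_insert_iff, Set.mem_singleton_iff] at hd
    omega
  have hr : (R.r : ℤ) ≠ 0 := by exact_mod_cast R.r_pos.ne'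
  -- The two halves differ only in whether the sink or the source is placed at the hub, and in the
  -- sign of the value.
  refine ⟨R.exists_embeds_iff_existsUnique_outlet hd5 hcoherent hlimited R.t R.s (.inr ⟨rfl, rfl⟩)
      R.r hr (fun W i => R.HasPass W (.spoke i) .hub) fun W i => ?_,
    R.exists_embeds_iff_existsUnique_outlet hd5 hcoherent hlimited R.s R.t (.inl ⟨rfl, rfl⟩)
      (-R.r) (neg_ne_zero.2 hr) (fun W i => R.HasPass W .hub (.spoke i)) fun W i => ?_⟩
  · rw [R.hasPass_iff]
    exact exists_congr fun φ => and_congr_right fun _ => and_comm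
  · exact R.hasPass_iff W _ _
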